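/- Let $n\ge 2$, let $\Omega_1',\dots,\Omega_n'$ be finite sets, let $\mu$ be a probability distribution on $\Omega_1'\times\cdots\times\Omega_n'$, and let $C>0$ be real. Let $\Omega=\bigsqcup_{i=1}^n\Omega_i'$, and let $\mu^{\mathrm{hom}}$ be the homogenization of $\mu$: the image of $\mu$ on $\binom{\Omega}{n}$ (the $n$-element subsets of $\Omega$) under $x\mapsto\{(x_1,1),\dots,(x_n,n)\}$. For $k\ge\ell$ let $D_{k\to\ell}$ be the Markov kernel from $\binom{\Omega}{k}$ to $\binom{\Omega}{\ell}$ with $D_{k\to\ell}(A,B)=\mathbf 1_{B\subseteq A}/\binom{k}{\ell}$, and let $\mu_\ell=\mu^{\mathrm{hom}}D_{n\to\ell}$. Let $U_{1\to2}(B,A)=\mathbf 1_{B\subseteq A}\,\mu_2(A)/\sum_{A'\supseteq B}\mu_2(A')$, for $B$ in the support of $\mu_1$, and let $P_{1\leftrightarrow2}=U_{1\to2}D_{2\to1}$ be the $1\leftrightarrow2$ up-down walk, a Markov chain on the support of $\mu_1$ that is reversible with respect to $\mu_1$. Let $\lambda_2(P_{1\leftrightarrow 2})$ be its second largest eigenvalue,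 counted with multiplicity. For $f(t)=(t-1)^2$ ($\chi^2$) or $f(t)=t\ln t$ (KL), put $D_f(\nu\|\pi)=\sum_x \pi(x) f(\nu(x)/\pi(x))$. A kernel $P$ satisfies $\rho$-contraction in $f$-divergence with respect to $\pi$ if $D_f(\nu P\|\pi P)\le\rho\,D_f(\nu\|\pi)$ for all probability distributions $\nu\ll\pi$. Contraction of $D_{k\to\ell}$ is understood with respect to $\mu_k$ (so with respect to $\mu^{\mathrm{hom}}$ if $k=n$). 1. If $D_{n\to n-1}$ satisfies $\left(1-\frac1{Cn}\right)$-contraction in $\chi^2$-divergence, then $D_{2\to1}$ satisfies $\left(1-\frac1{2(C+1)}\right)$-contraction in $\chi^2$-divergence, and $\lambda_2(P_{1\leftrightarrow2})\le 1-\frac1{2(C+1)}$. 2. If $D_{n\to n-1}$ satisfies $\left(1-\frac1{Cn}\right)$-contraction in KL-divergence (that is, $\mu$ satisfies $C$-approximate tensorization of entropy), then $D_{2\to1}$ satisfies $\left(1-\frac1{2(C+1)}\right)$-contraction in KL-divergence. -/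

import Mathlib

open scoped Matrix

noncomputable section

namespace DownUp

/-- `Slice α k` is the finite set of all `k`-element subsets of `α`. -/
abbrev Slice (α : Type*) (k : ℕ) : Type _ := {s : Finset α // s.card = k}

/-- The down operator from `k`-subsets to `l`-subsets: drop a uniformly random set of elements so
that `l` remain. Its entry at `(A, B)` is `1 / (k choose l)` if `B ⊆ A`, and `0` otherwise. -/
def down (α : Type*) [DecidableEq α] (k l : ℕ) : Matrix (Slice α k) (Slice α l) ℝ :=
  Matrix.of fun A B => if B.1 ⊆ A.1 then 1 / (k.choose l : ℝ) else 0

/-- The up operator from `l`-subsets to `k`-subsets with respect to `μ` on `k`-subsets. Its entry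
at `(B, A)` is `μ A / ∑ A' ⊇ B, μ A'` if `B ⊆ A`, and `0` otherwise. The rows that carry
probabilistic meaning are those `B` whose denominator is nonzero. -/
def up {α : Type*} [Fintype α] [DecidableEq α] {k : ℕ} (l : ℕ) (μ : Slice α k → ℝ) :
    Matrix (Slice α l) (Slice α k) ℝ :=
  Matrix.of fun B A =>
    if B.1 ⊆ A.1 then μ A / ∑ A' : Slice α k with B.1 ⊆ A'.1, μ A' else 0

/-- The distribution `μ_l = μ D_{k → l}` on `l`-subsets. -/
def marginal {α : Type*} [Fintype α] [DecidableEq α] {k : ℕ} (l : ℕ) (μ : Slice α k → ℝ) :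
    Slice α l → ℝ :=
  μ ᵥ* down α k l

/-- The `l ↔ k` up-down walk `U_{l → k} D_{k → l}` with respect to `μ` on `k`-subsets, as a Markov
chain on the support of its stationary distribution `μ_l` (the support is a closed class). -/
def upDownWalk {α : Type*} [Fintype α] [DecidableEq α] {k : ℕ} (l : ℕ) (μ : Slice α k → ℝ) :
    Matrix {B : Slice α l // marginal l μ B ≠ 0} {B : Slice α l // marginal l μ B ≠ 0} ℝ :=
  (up l μ * down α k l).submatrix Subtype.val Subtype.val

/-- The second largest eigenvalue, counted with multiplicity, of a square real matrix with real
spectrum (such as the transition matrix of a reversible chain): the entry of index `1` in the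
decreasing list of the roots of the characteristic polynomial. The value `1` is used if the list
has fewer than two entries. -/
def lambda2 {ι : Type*} [Fintype ι] [DecidableEq ι] (M : Matrix ι ι ℝ) : ℝ :=
  (M.charpoly.roots.sort (· ≥ ·)).getD 1 1

/-- The point `x` of the product, as the `n`-element set `{(1, x 1), …, (n, x n)}` in the disjoint
union of the factors. -/
def toSlice {n : ℕ} {S : Fin n → Type*} (x : ∀ i, S i) : Slice (Σ i, S i) n :=
  ⟨Finset.univ.map ⟨fun i => ⟨i, x i⟩, fun _ _ h => congrArg Sigma.fst h⟩, by simp⟩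

/-- The homogenization of `μ`: its image under `toSlice`. -/
def hom {n : ℕ} {S : Fin n → Type*} [∀ i, Fintype (S i)] [∀ i, DecidableEq (S i)]
    (μ : (∀ i, S i) → ℝ) : Slice (Σ i, S i) n → ℝ :=
  fun A => ∑ x : ∀ i, S i with toSlice x = A, μ x

/-- The `f`-divergence `E_{x ∼ μ} f (ν x / μ x)` on a finite set. -/
def fDiv {X : Type*} [Fintype X] (f : ℝ → ℝ) (ν μ : X → ℝ) : ℝ :=
  ∑ x, μ x * f (ν x / μ x)

/-- The generator of the `χ²`-divergence. -/
def chiSq (t : ℝ) : ℝ := (t - 1) ^ 2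

/-- The generator of the KL-divergence (with `0 log 0 = 0`). -/
def kl (t : ℝ) : ℝ := t * Real.log t

/-- `P` satisfies `ρ`-contraction in `f`-divergence with respect to `μ`: for all probability
distributions `ν ≪ μ`, `D_f(ν P ‖ μ P) ≤ ρ D_f(ν ‖ μ)`. -/
def Contracts {X Y : Type*} [Fintype X] [Fintype Y] (f : ℝ → ℝ) (ρ : ℝ) (P : Matrix X Y ℝ)
    (μ : X → ℝ) : Prop :=
  ∀ ν ∈ stdSimplex ℝ X, (∀ x, μ x = 0 → ν x = 0) →
    fDiv f (ν ᵥ* P) (μ ᵥ* P) ≤ ρ * fDiv f ν μ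

end DownUp

end

/-!
Write the homogenization as the image of `μ` on the full face, so that `μ₂` is the mixture of the
images `μ^e` of `μ` on the faces over uniformly random pairs `e` of coordinates.

A density that depends only on the coordinates in `e` has the same divergence on all faces between
`e` and the full one. Hence erasing a coordinate outside `e` loses nothing, the whole loss
`1 / (C n)` falls on the two coordinates of `e`, and erasing one of them contracts at rate
`1 - 1 / (2 C)` with respect to `μ^e`.

The chain rule splits a divergence relative to the mixture into that of the label `e` and the
entropies of the components. The label is a uniformly random edge of the complete graph, which the
down step replaces by one of its endpoints: this contracts at rate `1 / 2`. The components contract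
at rate `1 - 1 / (2 C)`, and mixing them under the posterior of `e` given the endpoint only helps,
because entropy is convex. Altogether `μ₂` contracts at rate `1 - 1 / (2 max(C, 1))`.

For `χ²`, contraction of the down step bounds by the same rate the Rayleigh quotients, on mean-zero
functions, of the symmetric matrix `Rᵀ R` conjugate to the up-down walk, hence bounds `λ₂`.
-/

noncomputable section

namespace DownUp

section Push

variable {X Y : Type*} [Fintype X] [Fintype Y]

/-- The pushforward of a mass function along a map of finite types. -/
abbrev push (φ : X → Y) : (X → ℝ) →ₗ[ℝ] Y → ℝ := FunOnFinite.linearMap ℝ ℝ φ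

theorem push_apply [DecidableEq Y] (φ : X → Y) (μ : X → ℝ) (y : Y) :
    push φ μ y = ∑ x with φ x = y, μ x :=
  FunOnFinite.linearMap_apply_apply ℝ ℝ φ μ y

theorem sum_push_mul (φ : X → Y) (μ : X → ℝ) (F : Y → ℝ) :
    ∑ y, push φ μ y * F y = ∑ x, μ x * F (φ x) := by
  classical
  rw [← Finset.sum_fiberwise Finset.univ φ]
  refine Finset.sum_congr rfl fun y _ => ?_
  rw [push_apply, Finset.sum_mul]
  refine Finset.sum_congr rfl fun x hx => ?_
  rw [(Finset.mem_filter.1 hx).2]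

theorem sum_push (φ : X → Y) (μ : X → ℝ) : ∑ y, push φ μ y = ∑ x, μ x := by
  simpa using sum_push_mul φ μ 1

theorem push_mul_comp (φ : X → Y) (μ : X → ℝ) (h : Y → ℝ) :
    push φ (μ * h ∘ φ) = push φ μ * h := by
  classical
  funext y
  rw [Pi.mul_apply, push_apply, push_apply, Finset.sum_mul]
  refine Finset.sum_congr rfl fun x hx => ?_
  rw [Pi.mul_apply, Function.comp_apply, (Finset.mem_filter.1 hx).2]

theorem exists_of_push_ne_zero {φ : X → Y} {μ : X → ℝ} {y : Y} (h : push φ μ y ≠ 0) :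
    ∃ x, φ x = y := by
  classical
  rw [push_apply] at h
  obtain ⟨x, hx, -⟩ := Finset.exists_ne_zero_of_sum_ne_zero h
  exact ⟨x, (Finset.mem_filter.1 hx).2⟩

theorem push_mem_stdSimplex (φ : X → Y) {μ : X → ℝ} (hμ : μ ∈ stdSimplex ℝ X) :
    push φ μ ∈ stdSimplex ℝ Y :=
  stdSimplex.image_linearMap φ ⟨μ, hμ, rfl⟩

end Push

section Dominated

variable {X Y : Type*} {μ ν : X → ℝ}

/-- The cone of unnormalised mass functions that are absolutely continuous with respect to `μ`. -/
def dominated (μ : X → ℝ) : Set (X → ℝ) := {ν | ∀ x, 0 ≤ ν x ∧ (μ x = 0 → ν x = 0)}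

theorem self_mem_dominated (hμ : ∀ x, 0 ≤ μ x) : μ ∈ dominated μ := fun x => ⟨hμ x, id⟩

theorem convex_dominated (μ : X → ℝ) : Convex ℝ (dominated μ) := by
  intro ν hν ν' hν' a b ha hb _ x
  refine ⟨add_nonneg (mul_nonneg ha (hν x).1) (mul_nonneg hb (hν' x).1), fun hx => ?_⟩
  simp [(hν x).2 hx, (hν' x).2 hx]

theorem smul_mem_dominated (hν : ν ∈ dominated μ) {c : ℝ} (hc : 0 ≤ c) : c • ν ∈ dominated μ :=
  fun x => ⟨mul_nonneg hc (hν x).1, fun hx => by simp [(hν x).2 hx]⟩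

theorem mul_mem_dominated {h : X → ℝ} (hμ : ∀ x, 0 ≤ μ x) (hh : ∀ x, 0 ≤ h x) :
    μ * h ∈ dominated μ :=
  fun x => ⟨mul_nonneg (hμ x) (hh x), fun hx => by simp [hx]⟩

theorem exists_eq_mul_of_mem_dominated (hμ : ∀ x, 0 ≤ μ x) (hν : ν ∈ dominated μ) :
    ∃ h : X → ℝ, (∀ x, 0 ≤ h x) ∧ ν = μ * h := by
  refine ⟨ν / μ, fun x => div_nonneg (hν x).1 (hμ x), funext fun x => ?_⟩
  by_cases hx : μ x = 0
  · simp [hx, (hν x).2 hx]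
  · simp [mul_div_cancel₀ _ hx]

theorem push_mem_dominated [Fintype X] [Fintype Y] (φ : X → Y) (hμ : ∀ x, 0 ≤ μ x)
    (hν : ν ∈ dominated μ) : push φ ν ∈ dominated (push φ μ) := by
  classical
  intro y
  rw [push_apply, push_apply, Finset.sum_eq_zero_iff_of_nonneg fun x _ => hμ x]
  exact ⟨Finset.sum_nonneg fun x _ => (hν x).1,
    fun h => Finset.sum_eq_zero fun x hx => (hν x).2 (h x hx)⟩

theorem vecMul_mem_dominated [Fintype X] {P : Matrix X Y ℝ} (hP : ∀ x y, 0 ≤ P x y)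
    (hμ : ∀ x, 0 ≤ μ x) (hν : ν ∈ dominated μ) : ν ᵥ* P ∈ dominated (μ ᵥ* P) := by
  intro y
  refine ⟨Finset.sum_nonneg fun x _ => mul_nonneg (hν x).1 (hP x y), fun h => ?_⟩
  have hzero := (Finset.sum_eq_zero_iff_of_nonneg fun x _ => mul_nonneg (hμ x) (hP x y)).1 h
  exact Finset.sum_eq_zero fun x hx =>
    mul_eq_zero.2 ((mul_eq_zero.1 (hzero x hx)).imp_left (hν x).2)

end Dominated

section FDiv

variable {X Y Z : Type*} [Fintype X] [Fintype Y] [Fintype Z] {f : ℝ → ℝ}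

theorem fDiv_mul_left (f : ℝ → ℝ) (μ h : X → ℝ) : fDiv f (μ * h) μ = ∑ x, μ x * f (h x) := by
  refine Finset.sum_congr rfl fun x _ => ?_
  by_cases hx : μ x = 0
  · simp [hx]
  · rw [Pi.mul_apply, mul_div_cancel_left₀ _ hx]

theorem fDiv_smul (f : ℝ → ℝ) (ν μ : X → ℝ) (c : ℝ) :
    fDiv f (c • ν) (c • μ) = c * fDiv f ν μ := by
  rcases eq_or_ne c 0 with rfl | hc
  · simp [fDiv]
  · simp only [fDiv, Pi.smul_apply, smul_eq_mul, mul_div_mul_left _ _ hc, Finset.mul_sum, mul_assoc]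

theorem fDiv_push_mul_comp (f : ℝ → ℝ) (φ : X → Y) (μ : X → ℝ) (h : Y → ℝ) :
    fDiv f (push φ μ * h) (push φ μ) = fDiv f (μ * h ∘ φ) μ := by
  rw [fDiv_mul_left, fDiv_mul_left]
  exact sum_push_mul φ μ fun y => f (h y)

theorem sum_mul_map_div_sum_le {ι : Type*} (hf : ConvexOn ℝ (Set.Ici 0) f) {s : Finset ι}
    {ν μ : ι → ℝ} (hν : ∀ i ∈ s, 0 ≤ ν i) (hμ : ∀ i ∈ s, 0 ≤ μ i)
    (hac : ∀ i ∈ s, μ i = 0 → ν i = 0) :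
    (∑ i ∈ s, μ i) * f ((∑ i ∈ s, ν i) / ∑ i ∈ s, μ i) ≤ ∑ i ∈ s, μ i * f (ν i / μ i) := by
  rcases (Finset.sum_nonneg hμ).eq_or_lt with h0 | hpos
  · rw [← h0, zero_mul, Finset.sum_eq_zero fun i hi => ?_]
    rw [(Finset.sum_eq_zero_iff_of_nonneg hμ).1 h0.symm i hi, zero_mul]
  set m := ∑ i ∈ s, μ i
  have hmean : ∑ i ∈ s, (μ i / m) • (ν i / μ i) = (∑ i ∈ s, ν i) / m := by
    rw [Finset.sum_div]
    refine Finset.sum_congr rfl fun i hi => ?_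
    by_cases hi0 : μ i = 0
    · simp [hi0, hac i hi hi0]
    · rw [smul_eq_mul, div_mul_div_cancel₀' hi0]
  have jensen := hf.map_sum_le (t := s) (w := fun i => μ i / m) (p := fun i => ν i / μ i)
    (fun i hi => div_nonneg (hμ i hi) hpos.le)
    (by rw [← Finset.sum_div, div_self hpos.ne']) fun i hi => div_nonneg (hν i hi) (hμ i hi)
  rw [hmean] at jensen
  calc m * f ((∑ i ∈ s, ν i) / m) ≤ m * ∑ i ∈ s, (μ i / m) • f (ν i / μ i) :=
        mul_le_mul_of_nonneg_left jensen hpos.le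
    _ = ∑ i ∈ s, μ i * f (ν i / μ i) := by
        simp only [Finset.mul_sum, smul_eq_mul, ← mul_assoc, mul_div_cancel₀ _ hpos.ne']

theorem fDiv_push_le (hf : ConvexOn ℝ (Set.Ici 0) f) (φ : X → Y) {ν μ : X → ℝ}
    (hμ : ∀ x, 0 ≤ μ x) (hν : ν ∈ dominated μ) : fDiv f (push φ ν) (push φ μ) ≤ fDiv f ν μ := by
  classical
  rw [fDiv, fDiv, ← Finset.sum_fiberwise Finset.univ φ]
  simp only [push_apply]
  exact Finset.sum_le_sum fun y _ => sum_mul_map_div_sum_le hf (fun x _ => (hν x).1)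
    (fun x _ => hμ x) fun x _ => (hν x).2

theorem fDiv_push_le_of_factorsThrough (hf : ConvexOn ℝ (Set.Ici 0) f) {φ : X → Y} {ψ : X → Z}
    (hψ : ψ.FactorsThrough φ) {ν μ : X → ℝ} (hμ : ∀ x, 0 ≤ μ x) (hν : ν ∈ dominated μ) :
    fDiv f (push ψ ν) (push ψ μ) ≤ fDiv f (push φ ν) (push φ μ) := by
  classical
  rcases isEmpty_or_nonempty X with hX | hX
  · simp [fDiv, push_apply]
  have := hX.map ψ
  obtain ⟨τ, rfl⟩ := (Function.factorsThrough_iff ψ).1 hψ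
  simp only [push, FunOnFinite.linearMap_comp, LinearMap.comp_apply]
  exact fDiv_push_le hf τ (fun y => (push_mem_dominated φ hμ (self_mem_dominated hμ) y).1)
    (push_mem_dominated φ hμ hν)

end FDiv

section Entropy

variable {X Y : Type*} [Fintype X] [Fintype Y] {f : ℝ → ℝ} {μ ν : X → ℝ}

/-- The `f`-entropy `E_μ f(h) - f(E_μ h)` of the density `h` of `ν` with respect to a probability
distribution `μ`. For a probability distribution `ν` and `f 1 = 0` it is `fDiv f ν μ`. -/
def entropy (f : ℝ → ℝ) (ν μ : X → ℝ) : ℝ := fDiv f ν μ - f (∑ x, ν x)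

theorem fDiv_nonneg (hf : ConvexOn ℝ (Set.Ici 0) f) (hf1 : f 1 = 0) (hμ : μ ∈ stdSimplex ℝ X)
    (hν : ν ∈ stdSimplex ℝ X) (hac : ∀ x, μ x = 0 → ν x = 0) : 0 ≤ fDiv f ν μ := by
  have := sum_mul_map_div_sum_le hf (s := Finset.univ) (fun x _ => hν.1 x) (fun x _ => hμ.1 x)
    fun x _ => hac x
  simpa [fDiv, hμ.2, hν.2, hf1] using this

theorem entropy_eq_fDiv (hf1 : f 1 = 0) (hν : ∑ x, ν x = 1) : entropy f ν μ = fDiv f ν μ := by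
  rw [entropy, hν, hf1, sub_zero]

theorem entropy_zero (hμ : ∑ x, μ x = 1) : entropy f 0 μ = 0 := by
  simp [entropy, fDiv, ← Finset.sum_mul, hμ]

theorem sum_mul_div_of_mem_dominated (hν : ν ∈ dominated μ) :
    ∑ x, μ x * (ν x / μ x) = ∑ x, ν x := by
  refine Finset.sum_congr rfl fun x _ => ?_
  by_cases hx : μ x = 0
  · rw [hx, zero_mul, (hν x).2 hx]
  · rw [mul_div_cancel₀ _ hx]

theorem entropy_smul {c κ p q : ℝ} (hf : ∀ t, 0 ≤ t → f (c * t) = κ * f t + p * t + q)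
    (hμ : μ ∈ stdSimplex ℝ X) (hν : ν ∈ dominated μ) :
    entropy f (c • ν) μ = κ * entropy f ν μ := by
  have hdiv : fDiv f (c • ν) μ = κ * fDiv f ν μ + p * ∑ x, ν x + q := by
    calc fDiv f (c • ν) μ = ∑ x, μ x * (κ * f (ν x / μ x) + p * (ν x / μ x) + q) := by
          refine Finset.sum_congr rfl fun x _ => ?_
          rw [← hf _ (div_nonneg (hν x).1 (hμ.1 x)), Pi.smul_apply, smul_eq_mul, mul_div_assoc]
      _ = ∑ x, (κ * (μ x * f (ν x / μ x)) + p * (μ x * (ν x / μ x)) + q * μ x) :=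
          Finset.sum_congr rfl fun x _ => by ring
      _ = κ * fDiv f ν μ + p * ∑ x, ν x + q := by
          simp only [Finset.sum_add_distrib, ← Finset.mul_sum]
          rw [hμ.2, sum_mul_div_of_mem_dominated hν, mul_one, fDiv]
  simp only [entropy, hdiv, Pi.smul_apply, smul_eq_mul, ← Finset.mul_sum]
  rw [hf _ (Finset.sum_nonneg fun x _ => (hν x).1)]
  ring

/-- The domain of a perspective: numerator and denominator, with the junk value `s / 0` excluded
unless `s = 0`. -/
def perspectiveDomain : Set (ℝ × ℝ) := {p | 0 ≤ p.1 ∧ 0 ≤ p.2 ∧ (p.2 = 0 → p.1 = 0)}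

/-- The properties of the generators `χ²` and KL that the argument needs: the Bregman divergence
of `f` (with `d` in the role of the derivative) is jointly convex, which makes the entropy a convex
function of `ν`, and rescaling the argument changes `f` by a scalar factor and an affine function,
which lets contraction be applied to unnormalised mass functions. -/
structure IsEntropyGenerator (f : ℝ → ℝ) : Prop where
  map_one : f 1 = 0
  scaling : ∀ c, 0 < c → ∃ κ, 0 ≤ κ ∧ ∃ p q, ∀ t, 0 ≤ t → f (c * t) = κ * f t + p * t + q
  convexOn_bregman : ∃ d : ℝ → ℝ,
    ConvexOn ℝ perspectiveDomain fun p => f p.1 - f p.2 - d p.2 * (p.1 - p.2)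

theorem convex_perspectiveDomain : Convex ℝ perspectiveDomain := by
  rintro ⟨s, t⟩ ⟨hs, ht, hst⟩ ⟨s', t'⟩ ⟨hs', ht', hst'⟩ a b ha hb _
  refine ⟨add_nonneg (mul_nonneg ha hs) (mul_nonneg hb hs'),
    add_nonneg (mul_nonneg ha ht) (mul_nonneg hb ht'), fun h => ?_⟩
  obtain ⟨hat, hbt⟩ := (add_eq_zero_iff_of_nonneg (mul_nonneg ha ht) (mul_nonneg hb ht')).1 h
  change a * s + b * s' = 0
  rw [mul_eq_zero.2 ((mul_eq_zero.1 hat).imp_right hst),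
    mul_eq_zero.2 ((mul_eq_zero.1 hbt).imp_right hst'), add_zero]

theorem IsEntropyGenerator.convexOn (hf : IsEntropyGenerator f) : ConvexOn ℝ (Set.Ici 0) f := by
  obtain ⟨d, hd⟩ := hf.convexOn_bregman
  refine ⟨convex_Ici 0, fun s hs s' hs' a b ha hb hab => ?_⟩
  have hconv := hd.2 (x := (s, 1)) ⟨hs, zero_le_one, by simp⟩ (y := (s', 1))
    ⟨hs', zero_le_one, by simp⟩ ha hb hab
  simp only [Prod.smul_mk, Prod.mk_add_mk, smul_eq_mul, mul_one, hab] at hconv ⊢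
  obtain rfl : b = 1 - a := by linarith
  linarith

theorem convexOn_entropy (hf : IsEntropyGenerator f) (hμ : μ ∈ stdSimplex ℝ X) :
    ConvexOn ℝ (dominated μ) fun ν => entropy f ν μ := by
  obtain ⟨d, hd⟩ := hf.convexOn_bregman
  have hentropy : ∀ ν ∈ dominated μ, ∑ x, μ x *
      (f (ν x / μ x) - f (∑ y, ν y) - d (∑ y, ν y) * (ν x / μ x - ∑ y, ν y)) =
        entropy f ν μ := by
    intro ν hν
    simp only [mul_sub, Finset.sum_sub_distrib, mul_left_comm (μ _) (d _), ← Finset.mul_sum,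
      ← Finset.sum_mul, hμ.2, sum_mul_div_of_mem_dominated hν]
    rw [entropy, fDiv]
    ring
  refine ConvexOn.congr ⟨convex_dominated μ, fun ν hν ν' hν' a b ha hb hab => ?_⟩ hentropy
  simp only [smul_eq_mul, Finset.mul_sum, ← Finset.sum_add_distrib]
  refine Finset.sum_le_sum fun x _ => ?_
  have hmem : ∀ ν ∈ dominated μ, (ν x / μ x, ∑ y, ν y) ∈ perspectiveDomain := fun ν hν =>
    ⟨div_nonneg (hν x).1 (hμ.1 x), Finset.sum_nonneg fun y _ => (hν y).1, fun h => by
      simp [(Finset.sum_eq_zero_iff_of_nonneg fun y _ => (hν y).1).1 h x (Finset.mem_univ x)]⟩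
  have hconv := mul_le_mul_of_nonneg_left (hd.2 (hmem ν hν) (hmem ν' hν') ha hb hab) (hμ.1 x)
  simp only [Prod.smul_mk, Prod.mk_add_mk, smul_eq_mul] at hconv
  simp only [Pi.add_apply, Pi.smul_apply, smul_eq_mul, Finset.sum_add_distrib, ← Finset.mul_sum,
    add_div, mul_div_assoc]
  refine hconv.trans_eq (by ring)

theorem entropy_sum_smul_le {ι : Type*} [Fintype ι] (hf : IsEntropyGenerator f)
    (hμ : μ ∈ stdSimplex ℝ X) {w : ι → ℝ} (hw : w ∈ stdSimplex ℝ ι) {N : ι → X → ℝ}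
    (hN : ∀ i, N i ∈ dominated μ) :
    entropy f (∑ i, w i • N i) μ ≤ ∑ i, w i * entropy f (N i) μ :=
  (convexOn_entropy hf hμ).map_sum_le (fun i _ => hw.1 i) hw.2 fun i _ => hN i

end Entropy

section Generators

theorem isEntropyGenerator_chiSq : IsEntropyGenerator chiSq where
  map_one := by simp [chiSq]
  scaling c _ := ⟨c ^ 2, sq_nonneg c, 2 * c ^ 2 - 2 * c, 1 - c ^ 2, fun t _ => by
    simp only [chiSq]; ring⟩
  convexOn_bregman := by
    refine ⟨fun t => 2 * (t - 1), ?_⟩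
    have hsq : ConvexOn ℝ Set.univ fun p : ℝ × ℝ => (p.1 - p.2) ^ 2 :=
      (even_two.convexOn_pow (𝕜 := ℝ)).comp_linearMap (LinearMap.fst ℝ ℝ ℝ - LinearMap.snd ℝ ℝ ℝ)
    refine (hsq.subset (Set.subset_univ _) convex_perspectiveDomain).congr fun p _ => ?_
    simp only [chiSq]
    ring

theorem convexOn_perspective {f : ℝ → ℝ} (hf : ConvexOn ℝ (Set.Ici 0) f) :
    ConvexOn ℝ perspectiveDomain fun p => p.2 * f (p.1 / p.2) := by
  refine ⟨convex_perspectiveDomain, fun p hp q hq a b ha hb _ => ?_⟩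
  have hac : ∀ {c : ℝ} {p : ℝ × ℝ}, p ∈ perspectiveDomain → c * p.2 = 0 → c * p.1 = 0 :=
    fun hp h => mul_eq_zero.2 ((mul_eq_zero.1 h).imp_right hp.2.2)
  have hscale : ∀ c s t : ℝ, c * t * f (c * s / (c * t)) = c * (t * f (s / t)) := by
    intro c s t
    rcases eq_or_ne c 0 with rfl | hc
    · simp
    · rw [mul_div_mul_left _ _ hc, mul_assoc]
  have hlogSum := sum_mul_map_div_sum_le hf (s := Finset.univ) (ν := ![a * p.1, b * q.1])
    (μ := ![a * p.2, b * q.2])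
    (by simpa [Fin.forall_fin_two] using ⟨mul_nonneg ha hp.1, mul_nonneg hb hq.1⟩)
    (by simpa [Fin.forall_fin_two] using ⟨mul_nonneg ha hp.2.1, mul_nonneg hb hq.2.1⟩)
    (by simpa only [Finset.mem_univ, forall_const, Fin.forall_fin_two] using ⟨hac hp, hac hq⟩)
  simpa [Fin.sum_univ_two, hscale] using hlogSum

theorem isEntropyGenerator_kl : IsEntropyGenerator kl where
  map_one := by simp [kl]
  scaling c hc := ⟨c, hc.le, c * Real.log c, 0, fun t ht => by
    rcases ht.eq_or_lt with rfl | ht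
    · simp [kl]
    · rw [kl, kl, Real.log_mul hc.ne' ht.ne']; ring⟩
  convexOn_bregman := by
    refine ⟨fun t => Real.log t + 1, ?_⟩
    have hlin : ConvexOn ℝ perspectiveDomain fun p : ℝ × ℝ => p.2 - p.1 :=
      (LinearMap.snd ℝ ℝ ℝ - LinearMap.fst ℝ ℝ ℝ).convexOn convex_perspectiveDomain
    refine ((convexOn_perspective Real.convexOn_mul_log).add hlin).congr fun p hp => ?_
    rcases eq_or_ne p.1 0 with hs | hs
    · simp [kl, hs]
      ring
    · have ht : p.2 ≠ 0 := fun ht => hs (hp.2.2 ht)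
      simp only [Pi.add_apply, kl, Real.log_div hs ht]
      field_simp
      ring

end Generators

section Contraction

variable {X Y : Type*} [Fintype X] [Fintype Y] {f : ℝ → ℝ} {ρ ρ' : ℝ} {P : Matrix X Y ℝ}
  {μ ν : X → ℝ}

theorem Contracts.mono (hf : ConvexOn ℝ (Set.Ici 0) f) (hf1 : f 1 = 0) (hμ : μ ∈ stdSimplex ℝ X)
    (h : Contracts f ρ P μ) (hρ : ρ ≤ ρ') : Contracts f ρ' P μ := fun ν hν hac =>
  (h ν hν hac).trans (mul_le_mul_of_nonneg_right hρ (fDiv_nonneg hf hf1 hμ hν hac))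

theorem sum_vecMul (hP : ∀ x, P x ∈ stdSimplex ℝ Y) (ν : X → ℝ) :
    ∑ y, (ν ᵥ* P) y = ∑ x, ν x := by
  simp only [Matrix.vecMul, dotProduct]
  rw [Finset.sum_comm]
  simp only [← Finset.mul_sum, (hP _).2, mul_one]

theorem vecMul_mem_stdSimplex (hP : ∀ x, P x ∈ stdSimplex ℝ Y) (hμ : μ ∈ stdSimplex ℝ X) :
    μ ᵥ* P ∈ stdSimplex ℝ Y :=
  ⟨fun y => Finset.sum_nonneg fun x _ => mul_nonneg (hμ.1 x) ((hP x).1 y),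
    (sum_vecMul hP μ).trans hμ.2⟩

theorem Contracts.entropy_le (hf : IsEntropyGenerator f) (hP : ∀ x, P x ∈ stdSimplex ℝ Y)
    (hμ : μ ∈ stdSimplex ℝ X) (h : Contracts f ρ P μ) (hν : ν ∈ dominated μ) :
    entropy f (ν ᵥ* P) (μ ᵥ* P) ≤ ρ * entropy f ν μ := by
  have hν0 : 0 ≤ ∑ x, ν x := Finset.sum_nonneg fun x _ => (hν x).1
  have hμP := vecMul_mem_stdSimplex hP hμ
  rcases hν0.eq_or_lt with h0 | hpos
  · obtain rfl : ν = 0 := funext fun x =>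
      (Finset.sum_eq_zero_iff_of_nonneg fun x _ => (hν x).1).1 h0.symm x (Finset.mem_univ x)
    simp [entropy_zero hμ.2, entropy_zero hμP.2]
  set c := ∑ x, ν x
  have hν₁ := smul_mem_dominated hν (inv_nonneg.2 hν0)
  have hν₁sum : ∑ x, (c⁻¹ • ν) x = 1 := by
    simp only [Pi.smul_apply, smul_eq_mul, ← Finset.mul_sum]
    exact inv_mul_cancel₀ hpos.ne'
  obtain ⟨κ, hκ, p, q, hscale⟩ := hf.scaling c hpos
  have hcancel : c • c⁻¹ • ν = ν := smul_inv_smul₀ hpos.ne' ν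
  have hcontr := h _ ⟨fun x => (hν₁ x).1, hν₁sum⟩ fun x => (hν₁ x).2
  rw [← entropy_eq_fDiv hf.map_one hν₁sum,
    ← entropy_eq_fDiv hf.map_one ((sum_vecMul hP _).trans hν₁sum)] at hcontr
  calc entropy f (ν ᵥ* P) (μ ᵥ* P) = κ * entropy f ((c⁻¹ • ν) ᵥ* P) (μ ᵥ* P) := by
        rw [← entropy_smul hscale hμP (vecMul_mem_dominated (fun x => (hP x).1) hμ.1 hν₁),
          ← Matrix.smul_vecMul, hcancel]
    _ ≤ κ * (ρ * entropy f (c⁻¹ • ν) μ) := mul_le_mul_of_nonneg_left hcontr hκ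
    _ = ρ * entropy f ν μ := by
        rw [mul_left_comm, ← entropy_smul hscale hμ hν₁, hcancel]

end Contraction

section Reversal

variable {X Y : Type*} [Fintype X] {P : Matrix X Y ℝ} {μ : X → ℝ}

/-- The time reversal (Bayes posterior) of the kernel `P` with respect to `μ`. Its row at `y` is
zero if `y` has mass zero under `μ ᵥ* P`. -/
def reversal (P : Matrix X Y ℝ) (μ : X → ℝ) : Matrix Y X ℝ :=
  Matrix.of fun y x => μ x * P x y / (μ ᵥ* P) y

theorem vecMul_mul_reversal (hP : ∀ x y, 0 ≤ P x y) (hμ : ∀ x, 0 ≤ μ x) (x : X) (y : Y) :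
    (μ ᵥ* P) y * reversal P μ y x = μ x * P x y := by
  refine mul_div_cancel_of_imp' fun h => ?_
  exact (Finset.sum_eq_zero_iff_of_nonneg fun x _ => mul_nonneg (hμ x) (hP x y)).1 h x
    (Finset.mem_univ x)

theorem vecMul_mul_apply_eq_zero (hP : ∀ x y, 0 ≤ P x y) (hμ : ∀ x, 0 ≤ μ x) (h : X → ℝ) {y : Y}
    (hy : (μ ᵥ* P) y = 0) : ((μ * h) ᵥ* P) y = 0 := by
  refine Finset.sum_eq_zero fun x _ => ?_
  rw [Pi.mul_apply, mul_right_comm, ← vecMul_mul_reversal hP hμ, hy, zero_mul, zero_mul]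

theorem reversal_mem_stdSimplex (hP : ∀ x y, 0 ≤ P x y) (hμ : ∀ x, 0 ≤ μ x) {y : Y}
    (hy : (μ ᵥ* P) y ≠ 0) : reversal P μ y ∈ stdSimplex ℝ X :=
  ⟨fun x => div_nonneg (mul_nonneg (hμ x) (hP x y))
      (Finset.sum_nonneg fun x _ => mul_nonneg (hμ x) (hP x y)),
    (Finset.sum_div _ _ _).symm.trans (div_self hy)⟩

theorem mul_sum_vecMul {W : Type*} [Fintype W] (hP : ∀ x y, 0 ≤ P x y) (hμ : ∀ x, 0 ≤ μ x)
    (N : X → W → ℝ) :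
    (μ * fun x => ∑ w, N x w) ᵥ* P =
      μ ᵥ* P * fun y => ∑ w, (∑ x, reversal P μ y x • N x) w := by
  funext y
  calc ∑ x, μ x * (∑ w, N x w) * P x y
      = ∑ x, (μ ᵥ* P) y * reversal P μ y x * ∑ w, N x w :=
        Finset.sum_congr rfl fun x _ => by rw [vecMul_mul_reversal hP hμ]; ring
    _ = (μ ᵥ* P) y * ∑ w, (∑ x, reversal P μ y x • N x) w := by
        simp only [Finset.sum_apply, Pi.smul_apply, smul_eq_mul]
        rw [Finset.sum_comm]
        simp only [Finset.mul_sum, mul_assoc]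

end Reversal

section Mixture

variable {X Y I : Type*} [Fintype X] [Fintype Y] [Fintype I] {φ : I → X → Y}

theorem sum_smul_push_apply (hφ : ∀ i j x y, φ i x = φ j y → i = j) (w : I → ℝ) (N : I → X → ℝ)
    (i : I) (x : X) : (∑ j, w j • push (φ j) (N j)) (φ i x) = w i * push (φ i) (N i) (φ i x) := by
  rw [Finset.sum_apply, Fintype.sum_eq_single i, Pi.smul_apply, smul_eq_mul]
  intro j hji
  by_contra hne
  obtain ⟨y, hy⟩ := exists_of_push_ne_zero (right_ne_zero_of_mul hne)
  exact hji (hφ _ _ _ _ hy)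

theorem fDiv_sum_smul_push (hφ : ∀ i j x y, φ i x = φ j y → i = j) (f : ℝ → ℝ) (w : I → ℝ)
    (N M : I → X → ℝ) :
    fDiv f (∑ i, w i • push (φ i) (N i)) (∑ i, w i • push (φ i) (M i)) =
      ∑ i, w i * fDiv f (push (φ i) (N i)) (push (φ i) (M i)) := by
  simp only [← fDiv_smul]
  unfold fDiv
  rw [Finset.sum_comm]
  refine Finset.sum_congr rfl fun y _ => ?_
  by_cases hy : ∃ i x, φ i x = y
  · obtain ⟨i, x, rfl⟩ := hy
    rw [sum_smul_push_apply hφ, sum_smul_push_apply hφ, Fintype.sum_eq_single i]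
    · rfl
    · refine fun j hji => mul_eq_zero_of_left (by_contra fun hne => ?_) _
      obtain ⟨z, hz⟩ := exists_of_push_ne_zero (right_ne_zero_of_mul hne)
      exact hji (hφ _ _ _ _ hz)
  · have hzero : ∀ i, push (φ i) (M i) y = 0 := fun i => by
      by_contra hne
      obtain ⟨x, hx⟩ := exists_of_push_ne_zero hne
      exact hy ⟨i, x, hx⟩
    simp [hzero]

theorem fDiv_sum_smul_push_eq_add (hφ : ∀ i j x y, φ i x = φ j y → i = j) (f : ℝ → ℝ) (w : I → ℝ)
    (N : I → X → ℝ) (μ : X → ℝ) :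
    fDiv f (∑ i, w i • push (φ i) (N i)) (∑ i, w i • push (φ i) μ) =
      fDiv f (w * fun i => ∑ x, N i x) w +
        ∑ i, w i * entropy f (push (φ i) (N i)) (push (φ i) μ) := by
  rw [fDiv_sum_smul_push hφ, fDiv_mul_left, ← Finset.sum_add_distrib]
  refine Finset.sum_congr rfl fun i _ => ?_
  rw [entropy, sum_push]
  ring

end Mixture

section MixtureKernel

variable {X Y Z I J : Type*} [Fintype X] [Fintype Y] [Fintype Z] [Fintype J] {f : ℝ → ℝ} {ρ : ℝ}
  {φ : I → X → Y} {ψ : J → X → Z} {P : Matrix Y Z ℝ} {Q : Matrix I J ℝ} {μ : X → ℝ} {w : I → ℝ}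
  {N : I → X → ℝ}

theorem entropy_push_vecMul (hψ : ∀ i j x y, ψ i x = ψ j y → i = j)
    (hPQ : ∀ i N, push (φ i) N ᵥ* P = ∑ j, Q i j • push (ψ j) N)
    (hQ : ∀ i, Q i ∈ stdSimplex ℝ J) (f : ℝ → ℝ) (i : I) (N μ : X → ℝ) :
    entropy f (push (φ i) N ᵥ* P) (push (φ i) μ ᵥ* P) =
      ∑ j, Q i j * entropy f (push (ψ j) N) (push (ψ j) μ) := by
  have hmass : ∑ z, (push (φ i) N ᵥ* P) z = ∑ x, N x := by
    simp only [hPQ, Finset.sum_apply, Pi.smul_apply, smul_eq_mul]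
    rw [Finset.sum_comm]
    simp only [← Finset.mul_sum, sum_push, ← Finset.sum_mul, (hQ i).2, one_mul]
  rw [entropy, hmass, hPQ, hPQ, fDiv_sum_smul_push hψ]
  simp only [entropy, mul_sub, Finset.sum_sub_distrib, sum_push, ← Finset.sum_mul, (hQ i).2,
    one_mul]

variable [Fintype I]

theorem sum_smul_push_vecMul (hPQ : ∀ i N, push (φ i) N ᵥ* P = ∑ j, Q i j • push (ψ j) N)
    (hQ : ∀ i j, 0 ≤ Q i j) (hw : ∀ i, 0 ≤ w i) (N : I → X → ℝ) :
    (∑ i, w i • push (φ i) (N i)) ᵥ* P =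
      ∑ j, (w ᵥ* Q) j • push (ψ j) (∑ i, reversal Q w j i • N i) := by
  simp only [Matrix.sum_vecMul, Matrix.smul_vecMul, hPQ, map_sum, map_smul, Finset.smul_sum,
    smul_smul, vecMul_mul_reversal hQ hw]
  exact Finset.sum_comm

theorem sum_smul_push_vecMul_const (hPQ : ∀ i N, push (φ i) N ᵥ* P = ∑ j, Q i j • push (ψ j) N)
    (w : I → ℝ) (μ : X → ℝ) :
    (∑ i, w i • push (φ i) μ) ᵥ* P = ∑ j, (w ᵥ* Q) j • push (ψ j) μ := by
  simp only [Matrix.sum_vecMul, Matrix.smul_vecMul, hPQ, Finset.smul_sum, smul_smul]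
  rw [Finset.sum_comm]
  simp only [← Finset.sum_smul]
  rfl

theorem sum_entropy_posterior_le (hf : IsEntropyGenerator f) (hQ : ∀ i j, 0 ≤ Q i j)
    (hw : ∀ i, 0 ≤ w i) (hμ : μ ∈ stdSimplex ℝ X) (hN : ∀ i, N i ∈ dominated μ) :
    ∑ j, (w ᵥ* Q) j * entropy f (push (ψ j) (∑ i, reversal Q w j i • N i)) (push (ψ j) μ) ≤
      ∑ i, w i * ∑ j, Q i j * entropy f (push (ψ j) (N i)) (push (ψ j) μ) := by
  calc ∑ j, (w ᵥ* Q) j * entropy f (push (ψ j) (∑ i, reversal Q w j i • N i)) (push (ψ j) μ)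
      ≤ ∑ j, ∑ i, (w ᵥ* Q) j * reversal Q w j i * entropy f (push (ψ j) (N i)) (push (ψ j) μ) := by
        refine Finset.sum_le_sum fun j _ => ?_
        rcases eq_or_ne ((w ᵥ* Q) j) 0 with hj | hj
        · simp [hj]
        simp only [map_sum, map_smul, mul_assoc, ← Finset.mul_sum]
        refine mul_le_mul_of_nonneg_left ?_
          (Finset.sum_nonneg fun i _ => mul_nonneg (hw i) (hQ i j))
        exact entropy_sum_smul_le hf (push_mem_stdSimplex _ hμ) (reversal_mem_stdSimplex hQ hw hj)
          fun i => push_mem_dominated _ hμ.1 (hN i)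
    _ = ∑ i, w i * ∑ j, Q i j * entropy f (push (ψ j) (N i)) (push (ψ j) μ) := by
        rw [Finset.sum_comm]
        simp only [vecMul_mul_reversal hQ hw, Finset.mul_sum, mul_assoc]

theorem contracts_mixture (hf : IsEntropyGenerator f) (hφ : ∀ i j x y, φ i x = φ j y → i = j)
    (hψ : ∀ i j x y, ψ i x = ψ j y → i = j)
    (hPQ : ∀ i N, push (φ i) N ᵥ* P = ∑ j, Q i j • push (ψ j) N)
    (hP : ∀ y, P y ∈ stdSimplex ℝ Z) (hQ : ∀ i, Q i ∈ stdSimplex ℝ J)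
    (hw : w ∈ stdSimplex ℝ I) (hμ : μ ∈ stdSimplex ℝ X) (hlabel : Contracts f ρ Q w)
    (hcomponent : ∀ i, Contracts f ρ P (push (φ i) μ)) :
    Contracts f ρ P (∑ i, w i • push (φ i) μ) := by
  intro ν hν hac
  have hmix : ∀ y, 0 ≤ (∑ i, w i • push (φ i) μ) y := fun y => by
    rw [Finset.sum_apply]
    exact Finset.sum_nonneg fun i _ => mul_nonneg (hw.1 i) ((push_mem_stdSimplex _ hμ).1 y)
  obtain ⟨h, hh, rfl⟩ := exists_eq_mul_of_mem_dominated hmix fun y => ⟨hν.1 y, hac y⟩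
  set N : I → X → ℝ := fun i => μ * h ∘ φ i with hN
  have hNdom : ∀ i, N i ∈ dominated μ := fun i => mul_mem_dominated hμ.1 fun x => hh (φ i x)
  have hdecomp : (∑ i, w i • push (φ i) μ) * h = ∑ i, w i • push (φ i) (N i) := by
    simp only [hN, push_mul_comp, Finset.sum_mul, smul_mul_assoc]
  have hmass : (w * fun i => ∑ x, N i x) ∈ stdSimplex ℝ I := by
    refine ⟨fun i => mul_nonneg (hw.1 i) (Finset.sum_nonneg fun x _ => (hNdom i x).1), ?_⟩
    rw [← hν.2, hdecomp]
    simp only [Finset.sum_apply, Pi.smul_apply, smul_eq_mul, Pi.mul_apply]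
    rw [Finset.sum_comm]
    simp only [← Finset.mul_sum, sum_push]
  have hlabels := hlabel _ hmass fun i hi => by simp [hi]
  have hcomponents := (sum_entropy_posterior_le (ψ := ψ) hf (fun i => (hQ i).1) hw.1 hμ hNdom).trans
    (Finset.sum_le_sum fun i _ => mul_le_mul_of_nonneg_left (a := w i)
      (((entropy_push_vecMul hψ hPQ hQ f i (N i) μ).ge).trans
        ((hcomponent i).entropy_le hf hP (push_mem_stdSimplex _ hμ)
          (push_mem_dominated _ hμ.1 (hNdom i)))) (hw.1 i))
  rw [hdecomp, sum_smul_push_vecMul hPQ (fun i => (hQ i).1) hw.1, sum_smul_push_vecMul_const hPQ,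
    fDiv_sum_smul_push_eq_add hψ, fDiv_sum_smul_push_eq_add hφ,
    ← mul_sum_vecMul (fun i => (hQ i).1) hw.1, mul_add, Finset.mul_sum]
  simp only [mul_left_comm ρ]
  exact add_le_add hlabels hcomponents

end MixtureKernel

section Down

variable {α : Type*} {k l : ℕ}

theorem sum_slice_eq_sum_powersetCard [Fintype α] (k : ℕ) (F : Finset α → ℝ) :
    ∑ A : Slice α k, F A.1 = ∑ s ∈ Finset.powersetCard k Finset.univ, F s :=
  (Finset.sum_subtype _ (by simp) F).symm

theorem sum_powersetCard_pred [DecidableEq α] {s : Finset α} (hs : s.Nonempty) (F : Finset α → ℝ) :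
    ∑ t ∈ s.powersetCard (s.card - 1), F t = ∑ a ∈ s, F (s.erase a) := by
  refine (Finset.sum_nbij s.erase (fun a ha => ?_) s.erase_injOn (fun t ht => ?_)
    fun a _ => rfl).symm
  · exact Finset.mem_powersetCard.2 ⟨s.erase_subset a, Finset.card_erase_of_mem ha⟩
  · obtain ⟨hts, hcard⟩ := Finset.mem_powersetCard.1 ht
    obtain ⟨a, hat, rfl⟩ := Finset.exists_eq_insert_iff.2
      ⟨hts, hcard ▸ Nat.sub_add_cancel hs.card_pos⟩
    exact ⟨a, Finset.mem_insert_self a t, Finset.erase_insert hat⟩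

variable [DecidableEq α]

theorem down_nonneg (A : Slice α k) (B : Slice α l) : 0 ≤ down α k l A B := by
  simp only [down, Matrix.of_apply]
  split_ifs <;> positivity

variable [Fintype α]

theorem sum_down_mul (A : Slice α k) (F : Finset α → ℝ) :
    ∑ B : Slice α l, down α k l A B * F B.1 =
      (∑ s ∈ A.1.powersetCard l, F s) / (k.choose l : ℝ) := by
  have hrow : ∀ B : Slice α l, down α k l A B * F B.1 =
      (if B.1 ⊆ A.1 then F B.1 else 0) / (k.choose l : ℝ) := fun B => by
    rw [down, Matrix.of_apply]
    split_ifs <;> ring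
  rw [Finset.sum_congr rfl fun B _ => hrow B, ← Finset.sum_div,
    sum_slice_eq_sum_powersetCard l fun s => if s ⊆ A.1 then F s else 0, ← Finset.sum_filter]
  congr 2
  ext s
  simp [Finset.mem_powersetCard, and_comm]

theorem sum_down_pred_mul (hk : 0 < k) (A : Slice α k) (F : Finset α → ℝ) :
    ∑ B : Slice α (k - 1), down α k (k - 1) A B * F B.1 = (∑ a ∈ A.1, F (A.1.erase a)) / k := by
  have hA : A.1.Nonempty := Finset.card_pos.1 (A.2.symm ▸ hk)
  have hsum := sum_powersetCard_pred hA F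
  rw [A.2] at hsum
  rw [sum_down_mul, hsum, Nat.choose_symm hk, Nat.choose_one_right]

theorem down_mem_stdSimplex (hl : l ≤ k) (A : Slice α k) :
    down α k l A ∈ stdSimplex ℝ (Slice α l) := by
  refine ⟨down_nonneg A, ?_⟩
  have hsum := sum_down_mul (l := l) A 1
  simp only [Pi.one_apply, mul_one, Finset.sum_const, Finset.card_powersetCard, A.2,
    nsmul_eq_mul] at hsum
  rw [hsum, div_self (mod_cast (Nat.choose_pos hl).ne')]

theorem marginal_mem_stdSimplex (hl : l ≤ k) {m : Slice α k → ℝ}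
    (hm : m ∈ stdSimplex ℝ (Slice α k)) : marginal l m ∈ stdSimplex ℝ (Slice α l) :=
  vecMul_mem_stdSimplex (down_mem_stdSimplex hl) hm

theorem up_eq_reversal_down (hl : l ≤ k) (m : Slice α k → ℝ) :
    up l m = reversal (down α k l) m := by
  have hchoose : (k.choose l : ℝ) ≠ 0 := mod_cast (Nat.choose_pos hl).ne'
  ext B A
  have hmass : (m ᵥ* down α k l) B = (∑ A : Slice α k with B.1 ⊆ A.1, m A) / k.choose l := by
    simp only [Matrix.vecMul, dotProduct, down, Matrix.of_apply, Finset.sum_div,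
      Finset.sum_filter]
    refine Finset.sum_congr rfl fun A _ => ?_
    split_ifs <;> ring
  rw [up, reversal, Matrix.of_apply, Matrix.of_apply, hmass, down, Matrix.of_apply]
  split_ifs
  · rw [mul_one_div, div_div_div_cancel_right₀ hchoose]
  · rw [mul_zero, zero_div]

end Down

section CompleteGraph

variable {α : Type*} [Fintype α] {f : ℝ → ℝ}

theorem sum_slice_one (F : Slice α 1 → ℝ) :
    ∑ A, F A = ∑ i, F ⟨{i}, Finset.card_singleton i⟩ := by
  have hbij : Function.Bijective fun i : α => (⟨{i}, Finset.card_singleton i⟩ : Slice α 1) := by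
    refine ⟨fun i j hij => Finset.singleton_injective (congrArg Subtype.val hij), fun A => ?_⟩
    obtain ⟨i, hi⟩ := Finset.card_eq_one.1 A.2
    exact ⟨i, Subtype.ext hi.symm⟩
  exact (hbij.sum_comp F).symm

/-- The uniform distribution on a finite type. -/
def uniform (X : Type*) [Fintype X] : X → ℝ := fun _ => (Fintype.card X : ℝ)⁻¹

theorem uniform_mem_stdSimplex (X : Type*) [Fintype X] [Nonempty X] :
    uniform X ∈ stdSimplex ℝ X :=
  ⟨fun _ => by unfold uniform; positivity, by simp [uniform]⟩

theorem uniform_slice_apply {k : ℕ} (A : Slice α k) :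
    uniform (Slice α k) A = ((Fintype.card α).choose k : ℝ)⁻¹ := by
  rw [uniform, Fintype.card_finset_len]

theorem nonempty_slice {k : ℕ} (hk : k ≤ Fintype.card α) : Nonempty (Slice α k) :=
  let ⟨s, hs⟩ := (Finset.exists_subset_card_eq (s := Finset.univ) hk)
  ⟨⟨s, hs.2⟩⟩

variable [DecidableEq α]

theorem sum_slice_two_of_mem (i : α) (F : Finset α → ℝ) :
    ∑ e : Slice α 2, (if i ∈ e.1 then F e.1 else 0) = ∑ j ∈ Finset.univ.erase i, F {i, j} := by
  rw [sum_slice_eq_sum_powersetCard 2 fun s => if i ∈ s then F s else 0, ← Finset.sum_filter]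
  refine (Finset.sum_nbij (fun j => ({i, j} : Finset α)) (fun j hj => ?_) (fun j hj j' _ h => ?_)
    (fun s hs => ?_) fun j _ => rfl).symm
  · simpa using Finset.card_pair (Finset.ne_of_mem_erase hj).symm
  · have hmem : j ∈ ({i, j'} : Finset α) := by simp [← show {i, j} = {i, j'} from h]
    simpa [Finset.ne_of_mem_erase hj] using hmem
  · obtain ⟨hs, his⟩ := Finset.mem_filter.1 hs
    obtain ⟨j, hj⟩ := Finset.card_eq_one.1
      ((Finset.card_erase_of_mem his).trans (by rw [(Finset.mem_powersetCard.1 hs).2]))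
    refine ⟨j, ?_, ?_⟩
    · have := hj ▸ Finset.mem_singleton_self j
      simpa using (Finset.mem_erase.1 this).1
    · simp only [← hj, Finset.insert_erase his]

theorem sum_sum_erase_pair (F : Finset α → ℝ) :
    ∑ i, ∑ j ∈ Finset.univ.erase i, F {i, j} = 2 * ∑ e : Slice α 2, F e.1 := by
  simp only [← sum_slice_two_of_mem]
  rw [Finset.sum_comm, Finset.mul_sum]
  refine Finset.sum_congr rfl fun e _ => ?_
  rw [← Finset.sum_filter, Finset.sum_const, Finset.filter_univ_mem, e.2, nsmul_eq_mul,
    Nat.cast_ofNat]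

theorem uniform_mul_vecMul_down_two_one_apply (hα : 2 ≤ Fintype.card α) (F : Finset α → ℝ) (i : α) :
    ((uniform (Slice α 2) * fun e => F e.1) ᵥ* down α 2 1) ⟨{i}, Finset.card_singleton i⟩ =
      (Fintype.card α : ℝ)⁻¹ * ((∑ j ∈ Finset.univ.erase i, F {i, j}) / (Fintype.card α - 1)) := by
  have hn : (2 : ℝ) ≤ Fintype.card α := mod_cast hα
  have hn₀ : (Fintype.card α : ℝ) ≠ 0 := by positivity
  have hn₁ : (Fintype.card α : ℝ) - 1 ≠ 0 := by linarith
  calc ∑ e : Slice α 2, uniform (Slice α 2) e * F e.1 * down α 2 1 e _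
      = ∑ e : Slice α 2, ((Fintype.card α).choose 2 : ℝ)⁻¹ / 2 * if i ∈ e.1 then F e.1 else 0 := by
        refine Finset.sum_congr rfl fun e _ => ?_
        simp only [uniform_slice_apply, down, Matrix.of_apply, Finset.singleton_subset_iff,
          Nat.choose_one_right]
        split_ifs <;> push_cast <;> ring
    _ = _ := by
        rw [← Finset.mul_sum, sum_slice_two_of_mem, Nat.cast_choose_two]
        field_simp

theorem uniform_vecMul_down_two_one_apply (hα : 2 ≤ Fintype.card α) (i : α) :
    (uniform (Slice α 2) ᵥ* down α 2 1) ⟨{i}, Finset.card_singleton i⟩ =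
      (Fintype.card α : ℝ)⁻¹ := by
  have hn : (2 : ℝ) ≤ Fintype.card α := mod_cast hα
  have hone := uniform_mul_vecMul_down_two_one_apply hα 1 i
  simp only [Pi.one_apply, Finset.sum_const, Finset.card_erase_of_mem (Finset.mem_univ i),
    Finset.card_univ, nsmul_eq_mul, mul_one, Nat.cast_pred (Fintype.card_pos_iff.2 ⟨i⟩)] at hone
  rwa [div_self (by linarith), mul_one, show (fun _ : Slice α 2 => (1 : ℝ)) = 1 from rfl,
    mul_one] at hone

theorem fDiv_uniform_mul_vecMul_down_two_one (f : ℝ → ℝ) (hα : 2 ≤ Fintype.card α)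
    (F : Finset α → ℝ) :
    fDiv f ((uniform (Slice α 2) * fun e => F e.1) ᵥ* down α 2 1)
        (uniform (Slice α 2) ᵥ* down α 2 1) =
      (Fintype.card α : ℝ)⁻¹ *
        ∑ i, f ((∑ j ∈ Finset.univ.erase i, F {i, j}) / (Fintype.card α - 1)) := by
  have hn : (Fintype.card α : ℝ)⁻¹ ≠ 0 := inv_ne_zero (by positivity)
  simp only [fDiv, sum_slice_one, uniform_mul_vecMul_down_two_one_apply hα,
    uniform_vecMul_down_two_one_apply hα, Finset.mul_sum, mul_div_cancel_left₀ _ hn]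

/-- Filling the diagonal of `a` with the row means `b` makes the rows average to `b`, so convexity
of the entropy compares the entropy of `b` with those of the rows. -/
theorem sum_map_le_sum_sum_erase [Nonempty α] (hf : IsEntropyGenerator f) {a : α → α → ℝ}
    {b : α → ℝ} (ha : ∀ i j, 0 ≤ a i j) (hsymm : ∀ i j, a i j = a j i) (hb : ∀ i, 0 ≤ b i)
    (hab : ∀ i, ∑ j ∈ Finset.univ.erase i, a i j = (Fintype.card α - 1) * b i)
    (hsum : ∑ i, b i = Fintype.card α) :
    (2 * Fintype.card α - 1) * ∑ i, f (b i) ≤ ∑ i, ∑ j ∈ Finset.univ.erase i, f (a i j) := by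
  have hn : (0 : ℝ) < Fintype.card α := mod_cast Fintype.card_pos
  set n : ℝ := (Fintype.card α : ℝ)
  have hu := uniform_mem_stdSimplex α
  have hun : ∀ i, uniform α i = n⁻¹ := fun _ => rfl
  set u := uniform α
  set r : α → α → ℝ := fun i => Function.update (a i) i (b i)
  have hrow : ∀ (g : ℝ → ℝ) (i : α), ∑ j, g (r i j) =
      g (b i) + ∑ j ∈ Finset.univ.erase i, g (a i j) := fun g i => by
    rw [← Finset.add_sum_erase _ _ (Finset.mem_univ i)]
    congr 1
    · simp [r]
    · exact Finset.sum_congr rfl fun j hj => by simp [r, Finset.ne_of_mem_erase hj]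
  have hsymm' : ∀ i j, r i j = r j i := fun i j => by
    rcases eq_or_ne i j with rfl | hij
    · rfl
    · simp [r, hij, hij.symm, hsymm i j]
  have hrowsum : ∀ i, ∑ j, r i j = n * b i := fun i => by
    refine (hrow id i).trans ?_
    simp only [id, hab]
    ring
  have hmean : ∑ i, u i • (u * r i) = u * b := by
    funext j
    simp only [Finset.sum_apply, Pi.smul_apply, Pi.mul_apply, smul_eq_mul, hsymm' _ j, hun,
      ← Finset.mul_sum, hrowsum j, inv_mul_cancel_left₀ hn.ne']
  have hdom : ∀ i, u * r i ∈ dominated u := fun i => mul_mem_dominated hu.1 fun j => by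
    rcases eq_or_ne j i with rfl | hji
    · simpa [r] using hb j
    · simpa [r, hji] using ha i j
  have hconv := entropy_sum_smul_le hf hu hu hdom
  rw [hmean] at hconv
  simp only [entropy, fDiv_mul_left, Pi.mul_apply, hun, ← Finset.mul_sum, hsum, hrowsum, hrow f,
    inv_mul_cancel₀ hn.ne', inv_mul_cancel_left₀ hn.ne', hf.map_one, Finset.sum_sub_distrib,
    Finset.sum_add_distrib] at hconv
  field_simp at hconv
  linarith

theorem contracts_down_two_one_uniform (hf : IsEntropyGenerator f) (hα : 2 ≤ Fintype.card α) :
    Contracts f (1 / 2) (down α 2 1) (uniform (Slice α 2)) := by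
  have hne : Nonempty α := Fintype.card_pos_iff.1 (by omega)
  have hne₂ := nonempty_slice hα
  have hn : (2 : ℝ) ≤ Fintype.card α := mod_cast hα
  have hn₁ : (0 : ℝ) < Fintype.card α - 1 := by linarith
  have hunif := uniform_mem_stdSimplex (Slice α 2)
  intro ν hν hac
  obtain ⟨h, hh, rfl⟩ := exists_eq_mul_of_mem_dominated hunif.1 fun e => ⟨hν.1 e, hac e⟩
  obtain ⟨F, hF, rfl⟩ : ∃ F : Finset α → ℝ, (∀ s, 0 ≤ F s) ∧ h = fun e => F e.1 :=
    ⟨fun s => if hs : s.card = 2 then h ⟨s, hs⟩ else 0,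
      fun s => by dsimp only; split_ifs <;> simp [hh], funext fun e => by simp [e.2]⟩
  have hD := down_mem_stdSimplex (α := α) one_le_two
  have hνD := uniform_mul_vecMul_down_two_one_apply hα F
  set b : α → ℝ := fun i => (∑ j ∈ Finset.univ.erase i, F {i, j}) / (Fintype.card α - 1)
  have hbsum : ∑ i, b i = Fintype.card α := by
    have hmass := (sum_vecMul hD _).trans hν.2
    simp only [sum_slice_one, hνD, ← Finset.mul_sum] at hmass
    field_simp at hmass
    exact hmass
  have hdiv : fDiv f _ _ = (Fintype.card α : ℝ)⁻¹ * ∑ i, f (b i) :=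
    fDiv_uniform_mul_vecMul_down_two_one f hα F
  have hnonneg : 0 ≤ ∑ i, f (b i) := by
    have := fDiv_nonneg hf.convexOn hf.map_one (vecMul_mem_stdSimplex hD hunif)
      (vecMul_mem_stdSimplex hD hν) fun B =>
        (vecMul_mem_dominated down_nonneg hunif.1 (fun e => ⟨hν.1 e, hac e⟩) B).2
    rw [hdiv] at this
    exact nonneg_of_mul_nonneg_right this (by positivity)
  have hmain := sum_map_le_sum_sum_erase hf (a := fun i j => F {i, j}) (fun i j => hF _)
    (fun i j => by rw [Finset.pair_comm])
    (fun i => div_nonneg (Finset.sum_nonneg fun j _ => hF _) hn₁.le)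
    (fun i => (mul_div_cancel₀ _ hn₁.ne').symm) hbsum
  rw [sum_sum_erase_pair fun s => f (F s)] at hmain
  rw [hdiv, fDiv_mul_left]
  simp only [uniform_slice_apply, ← Finset.mul_sum, Nat.cast_choose_two]
  field_simp
  linarith

end CompleteGraph

section Face

variable {ι : Type*} {S : ι → Type*} {k l : ℕ}

/-- The `k`-element subset `{(i, x i) | i ∈ e}` of the disjoint union of the factors, that is, the
part of the point `x` over the coordinates in `e`. -/
def face (e : Slice ι k) (x : ∀ i, S i) : Slice (Σ i, S i) k :=
  ⟨e.1.map ⟨fun i => ⟨i, x i⟩, fun _ _ h => congrArg Sigma.fst h⟩, by simpa using e.2⟩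

variable {e e' : Slice ι k} {x y : ∀ i, S i}

theorem mem_face {v : Σ i, S i} : v ∈ (face e x).1 ↔ v.1 ∈ e.1 ∧ x v.1 = v.2 := by
  obtain ⟨i, s⟩ := v
  simp only [face, Finset.mem_map]
  constructor
  · rintro ⟨j, hj, h⟩
    cases h
    exact ⟨hj, rfl⟩
  · rintro ⟨hi, rfl⟩
    exact ⟨i, hi, rfl⟩

theorem face_eq_face_iff : face e x = face e y ↔ ∀ i ∈ e.1, x i = y i := by
  constructor
  · intro h i hi
    have hmem : (⟨i, x i⟩ : Σ i, S i) ∈ (face e y).1 := h ▸ mem_face.2 ⟨hi, rfl⟩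
    exact (mem_face.1 hmem).2.symm
  · intro h
    refine Subtype.ext (Finset.ext fun v => ?_)
    rw [mem_face, mem_face]
    exact and_congr_right fun hv => by rw [h _ hv]

theorem eq_of_face_eq_face (h : face e x = face e' y) : e = e' := by
  have hle : ∀ {e e' : Slice ι k} {x y : ∀ i, S i}, face e x = face e' y → e.1 ⊆ e'.1 :=
    fun {e e' x y} h i hi => by
      have hmem : (⟨i, x i⟩ : Σ i, S i) ∈ (face e' y).1 := h ▸ mem_face.2 ⟨hi, rfl⟩
      exact (mem_face.1 hmem).1
  exact Subtype.ext ((hle h).antisymm (hle h.symm))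

theorem face_factorsThrough {e : Slice ι k} {e' : Slice ι l} (h : e'.1 ⊆ e.1) :
    (face e' : (∀ i, S i) → _).FactorsThrough (face e) := fun _ _ hxy =>
  face_eq_face_iff.2 fun i hi => face_eq_face_iff.1 hxy i (h hi)

theorem exists_face_eq_iff_subset_face {B : Slice (Σ i, S i) l} :
    (∃ e' : Slice ι l, e'.1 ⊆ e.1 ∧ face e' x = B) ↔ B.1 ⊆ (face e x).1 := by
  classical
  constructor
  · rintro ⟨e', he', rfl⟩ v hv
    rw [mem_face] at hv ⊢
    exact ⟨he' hv.1, hv.2⟩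
  · intro h
    have hinj : Set.InjOn Sigma.fst (B.1 : Set (Σ i, S i)) := by
      rintro ⟨i, s⟩ hs ⟨j, t⟩ ht (rfl : i = j)
      exact Sigma.ext rfl (heq_of_eq ((mem_face.1 (h hs)).2.symm.trans (mem_face.1 (h ht)).2))
    refine ⟨⟨B.1.image Sigma.fst, by rw [Finset.card_image_of_injOn hinj, B.2]⟩,
      Finset.image_subset_iff.2 fun v hv => (mem_face.1 (h hv)).1, Subtype.ext ?_⟩
    refine (Finset.eq_of_subset_of_card_le (fun v hv => ?_)
      ((face _ x).2.trans B.2.symm).le).symm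
    exact mem_face.2 ⟨Finset.mem_image_of_mem _ hv, (mem_face.1 (h hv)).2⟩

variable [Fintype ι] [DecidableEq ι] [∀ i, DecidableEq (S i)]

theorem down_face_apply (e : Slice ι k) (x : ∀ i, S i) (B : Slice (Σ i, S i) l) :
    down (Σ i, S i) k l (face e x) B =
      ∑ e' : Slice ι l, if face e' x = B then down ι k l e e' else 0 := by
  by_cases h : B.1 ⊆ (face e x).1
  · obtain ⟨e', he', rfl⟩ := exists_face_eq_iff_subset_face.2 h
    rw [Fintype.sum_eq_single e' fun e'' hne => if_neg fun heq => hne (eq_of_face_eq_face heq),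
      if_pos rfl]
    simp only [down, Matrix.of_apply, if_pos h, if_pos he']
  · rw [down, Matrix.of_apply, if_neg h]
    refine (Finset.sum_eq_zero fun e' _ => ite_eq_right_iff.2 fun heq => if_neg fun hsub => ?_).symm
    exact h (exists_face_eq_iff_subset_face.1 ⟨e', hsub, heq⟩)

variable [∀ i, Fintype (S i)]

theorem push_face_vecMul_down (e : Slice ι k) (N : (∀ i, S i) → ℝ) :
    push (face e) N ᵥ* down (Σ i, S i) k l =
      ∑ e' : Slice ι l, down ι k l e e' • push (face e') N := by
  funext B
  calc (push (face e) N ᵥ* down (Σ i, S i) k l) B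
      = ∑ x, N x * down (Σ i, S i) k l (face e x) B :=
        sum_push_mul (face e) N fun A => down (Σ i, S i) k l A B
    _ = (∑ e' : Slice ι l, down ι k l e e' • push (face e') N) B := by
        simp only [down_face_apply, Finset.sum_apply, Pi.smul_apply, smul_eq_mul, push_apply,
          Finset.mul_sum, Finset.sum_filter]
        rw [Finset.sum_comm]
        refine Finset.sum_congr rfl fun e' _ => Finset.sum_congr rfl fun x _ => ?_
        split_ifs <;> ring

end Face

section Homogenization

variable {n : ℕ} {S : Fin n → Type*} [∀ i, Fintype (S i)] [∀ i, DecidableEq (S i)]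

/-- The full index set as a slice. -/
def fullSlice (n : ℕ) : Slice (Fin n) n := ⟨Finset.univ, Finset.card_fin n⟩

theorem hom_eq_push (μ : (∀ i, S i) → ℝ) : hom μ = push (face (fullSlice n)) μ :=
  funext fun A => (push_apply (face (fullSlice n)) μ A).symm

theorem hom_mem_stdSimplex {μ : (∀ i, S i) → ℝ} (hμ : μ ∈ stdSimplex ℝ (∀ i, S i)) :
    hom μ ∈ stdSimplex ℝ (Slice (Σ i, S i) n) :=
  hom_eq_push μ ▸ push_mem_stdSimplex _ hμ

theorem marginal_hom (l : ℕ) (μ : (∀ i, S i) → ℝ) :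
    marginal l (hom μ) = ∑ e : Slice (Fin n) l, uniform (Slice (Fin n) l) e • push (face e) μ := by
  rw [marginal, hom_eq_push, push_face_vecMul_down]
  simp only [uniform_slice_apply, Fintype.card_fin, down, Matrix.of_apply, fullSlice,
    Finset.subset_univ, if_true, one_div]

end Homogenization

section Localization

variable {ι : Type*} {S : ι → Type*} [Fintype ι] [DecidableEq ι] [∀ i, Fintype (S i)]
  {f : ℝ → ℝ} {k K : ℕ} {μ N M : (∀ i, S i) → ℝ}

/-- The `f`-divergence between the marginals of `N` and `M` on the coordinates in `s`. -/
def faceDiv (f : ℝ → ℝ) (N M : (∀ i, S i) → ℝ) (s : Finset ι) : ℝ :=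
  fDiv f (push (face ⟨s, rfl⟩) N) (push (face ⟨s, rfl⟩) M)

theorem fDiv_push_face (f : ℝ → ℝ) (N M : (∀ i, S i) → ℝ) (e : Slice ι k) :
    fDiv f (push (face e) N) (push (face e) M) = faceDiv f N M e.1 := by
  obtain ⟨s, rfl⟩ := e
  rfl

theorem faceDiv_mono (hf : ConvexOn ℝ (Set.Ici 0) f) (hM : ∀ x, 0 ≤ M x) (hN : N ∈ dominated M)
    {s t : Finset ι} (hst : s ⊆ t) : faceDiv f N M s ≤ faceDiv f N M t :=
  fDiv_push_le_of_factorsThrough hf (face_factorsThrough (e := ⟨t, rfl⟩) (e' := ⟨s, rfl⟩) hst) hM hN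

theorem sum_faceDiv_erase_add_le (hf : ConvexOn ℝ (Set.Ici 0) f) (hM : ∀ x, 0 ≤ M x)
    (hN : N ∈ dominated M) {s t : Finset ι} (hst : s ⊆ t) :
    ∑ i ∈ s, faceDiv f N M (s.erase i) + ((t.card : ℝ) - s.card) * faceDiv f N M s ≤
      ∑ i ∈ t, faceDiv f N M (t.erase i) := by
  rw [← Finset.sum_sdiff hst, add_comm, ← Nat.cast_sub (Finset.card_le_card hst),
    ← Finset.card_sdiff_of_subset hst, ← nsmul_eq_mul]
  refine add_le_add (Finset.card_nsmul_le_sum _ _ _ fun i hi => ?_)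
    (Finset.sum_le_sum fun i _ => faceDiv_mono hf hM hN (Finset.erase_subset_erase i hst))
  exact faceDiv_mono hf hM hN (Finset.subset_erase.2 ⟨hst, (Finset.mem_sdiff.1 hi).2⟩)

variable [∀ i, DecidableEq (S i)]

theorem fDiv_push_face_vecMul_down_pred (hk : 0 < k) (f : ℝ → ℝ) (N M : (∀ i, S i) → ℝ)
    (e : Slice ι k) :
    fDiv f (push (face e) N ᵥ* down (Σ i, S i) k (k - 1))
        (push (face e) M ᵥ* down (Σ i, S i) k (k - 1)) =
      (∑ i ∈ e.1, faceDiv f N M (e.1.erase i)) / k := by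
  rw [push_face_vecMul_down, push_face_vecMul_down,
    fDiv_sum_smul_push fun _ _ _ _ => eq_of_face_eq_face, ← sum_down_pred_mul hk]
  simp only [fDiv_push_face]

/-- A density that depends only on the coordinates in `e` has the same divergence on every face
between `e` and `t`, so each coordinate of `t` outside `e` is erased at no loss. -/
theorem Contracts.push_face_of_subset (hf : ConvexOn ℝ (Set.Ici 0) f)
    (hμ : μ ∈ stdSimplex ℝ (∀ i, S i)) {ε : ℝ} {t : Slice ι K} {e : Slice ι k} (hk : 0 < k)
    (het : e.1 ⊆ t.1)
    (h : Contracts f (1 - ε / K) (down (Σ i, S i) K (K - 1)) (push (face t) μ)) :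
    Contracts f (1 - ε / k) (down (Σ i, S i) k (k - 1)) (push (face e) μ) := by
  intro ν hν hac
  obtain ⟨g, hg, rfl⟩ := exists_eq_mul_of_mem_dominated (push_mem_stdSimplex (face e) hμ).1
    fun A => ⟨hν.1 A, hac A⟩
  have hkK : k ≤ K := by simpa only [e.2, t.2] using Finset.card_le_card het
  set N := μ * g ∘ face e
  have hN : N ∈ dominated μ := mul_mem_dominated hμ.1 fun x => hg _
  rw [← push_mul_comp] at hν ⊢
  have hNmem : N ∈ stdSimplex ℝ (∀ i, S i) :=
    ⟨fun x => (hN x).1, (sum_push (face e) N).symm.trans hν.2⟩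
  have hdiv : faceDiv f N μ t.1 = faceDiv f N μ e.1 := by
    refine le_antisymm ?_ (faceDiv_mono hf hμ.1 hN het)
    rw [← fDiv_push_face, ← fDiv_push_face f N μ e, push_mul_comp (face e), fDiv_push_mul_comp]
    exact fDiv_push_le hf _ hμ.1 hN
  have hfull := h _ (push_mem_stdSimplex (face t) hNmem) fun A =>
    (push_mem_dominated (face t) hμ.1 hN A).2
  rw [fDiv_push_face_vecMul_down_pred (hk.trans_le hkK), fDiv_push_face, hdiv,
    div_le_iff₀ (mod_cast hk.trans_le hkK)] at hfull
  have herase := sum_faceDiv_erase_add_le hf hμ.1 hN het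
  rw [e.2, t.2] at herase
  rw [fDiv_push_face_vecMul_down_pred hk, fDiv_push_face, div_le_iff₀ (mod_cast hk)]
  have hk' : (k : ℝ) ≠ 0 := mod_cast hk.ne'
  have hK' : (K : ℝ) ≠ 0 := mod_cast (hk.trans_le hkK).ne'
  calc ∑ i ∈ e.1, faceDiv f N μ (e.1.erase i)
      ≤ (1 - ε / K) * faceDiv f N μ e.1 * K - (K - k) * faceDiv f N μ e.1 := by linarith
    _ = (1 - ε / k) * faceDiv f N μ e.1 * k := by field_simp; ring

end Localization

section PairMarginal

variable {n : ℕ} {S : Fin n → Type*} [∀ i, Fintype (S i)] [∀ i, DecidableEq (S i)]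
  {f : ℝ → ℝ} {μ : (∀ i, S i) → ℝ}

theorem Contracts.marginal_two (hf : IsEntropyGenerator f) (hn : 2 ≤ n)
    (hμ : μ ∈ stdSimplex ℝ (∀ i, S i)) {C : ℝ} (hC : 0 < C)
    (h : Contracts f (1 - 1 / (C * n)) (down (Σ i, S i) n (n - 1)) (hom μ)) :
    Contracts f (1 - 1 / (2 * max C 1)) (down (Σ i, S i) 2 1) (marginal 2 (hom μ)) := by
  have hcard : 2 ≤ Fintype.card (Fin n) := by rwa [Fintype.card_fin]
  have := nonempty_slice hcard
  have hlabel : Contracts f (1 - 1 / (2 * max C 1)) (down (Fin n) 2 1)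
      (uniform (Slice (Fin n) 2)) := by
    refine (contracts_down_two_one_uniform hf hcard).mono hf.convexOn hf.map_one
      (uniform_mem_stdSimplex _) ?_
    have : 1 / (2 * max C 1) ≤ 1 / 2 :=
      one_div_le_one_div_of_le two_pos (by linarith [le_max_right C 1])
    linarith
  have hcomponent (e : Slice (Fin n) 2) :
      Contracts f (1 - 1 / (2 * max C 1)) (down (Σ i, S i) 2 1) (push (face e) μ) := by
    rw [hom_eq_push, ← div_div] at h
    refine (h.push_face_of_subset hf.convexOn hμ two_pos (Finset.subset_univ e.1)).mono
      hf.convexOn hf.map_one (push_mem_stdSimplex _ hμ) (sub_le_sub_left ?_ 1)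
    rw [div_div, mul_comm C]
    exact one_div_le_one_div_of_le (by positivity)
      (mul_le_mul_of_nonneg_left (le_max_left C 1) zero_le_two)
  rw [marginal_hom]
  exact contracts_mixture hf (fun _ _ _ _ => eq_of_face_eq_face)
    (fun _ _ _ _ => eq_of_face_eq_face) push_face_vecMul_down (down_mem_stdSimplex one_le_two)
    (down_mem_stdSimplex one_le_two) (uniform_mem_stdSimplex _) hμ hlabel hcomponent

end PairMarginal

section Lambda2

variable {ι : Type*} [Fintype ι] [DecidableEq ι] {A : Matrix ι ι ℝ}

theorem lambda2_eq_eigenvalues₀ (hA : A.IsHermitian) (hι : 1 < Fintype.card ι) :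
    lambda2 A = hA.eigenvalues₀ ⟨1, hι⟩ := by
  have hsort := hA.sort_roots_charpoly_eq_eigenvalues₀
  rw [show A.charpoly.roots.map (RCLike.re : ℝ → ℝ) = A.charpoly.roots by simp] at hsort
  rw [lambda2, hsort, List.getD_eq_getElem _ _ (by rwa [List.length_ofFn]), List.getElem_ofFn]

theorem exists_orthonormal_eigenvectors (hA : A.IsHermitian) (hι : 1 < Fintype.card ι) :
    ∃ (u v : ι → ℝ) (l : ℝ), u ⬝ᵥ u = 1 ∧ v ⬝ᵥ v = 1 ∧ u ⬝ᵥ v = 0 ∧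
      A *ᵥ u = lambda2 A • u ∧ A *ᵥ v = l • v ∧ lambda2 A ≤ l := by
  set φ := Fintype.equivOfCardEq (Fintype.card_fin (Fintype.card ι))
  have heigenvalues (k : Fin (Fintype.card ι)) : hA.eigenvalues (φ k) = hA.eigenvalues₀ k :=
    congrArg hA.eigenvalues₀ (φ.symm_apply_apply k)
  set b : ι → ι → ℝ := fun i => (hA.eigenvectorBasis i).ofLp with hb
  have horthonormal (i j : ι) : b i ⬝ᵥ b j = if i = j then 1 else 0 := by
    rw [← orthonormal_iff_ite.1 hA.eigenvectorBasis.orthonormal i j,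
      EuclideanSpace.inner_eq_star_dotProduct, dotProduct_comm]
    simp [hb]
  have heigenvector (k : Fin (Fintype.card ι)) :
      A *ᵥ b (φ k) = hA.eigenvalues₀ k • b (φ k) := by
    rw [← heigenvalues]
    exact hA.mulVec_eigenvectorBasis (φ k)
  have hzero : 0 < Fintype.card ι := by omega
  refine ⟨b (φ ⟨1, hι⟩), b (φ ⟨0, hzero⟩), hA.eigenvalues₀ ⟨0, hzero⟩, ?_⟩
  rw [lambda2_eq_eigenvalues₀ hA hι]
  exact ⟨(horthonormal _ _).trans (if_pos rfl), (horthonormal _ _).trans (if_pos rfl),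
    (horthonormal _ _).trans (if_neg (φ.injective.ne (by simp))), heigenvector _, heigenvector _,
    hA.eigenvalues₀_antitone (by simp)⟩

theorem lambda2_le_of_forall_dotProduct_mulVec_le (hA : A.IsHermitian) (hι : 1 < Fintype.card ι)
    (w : ι → ℝ) {ρ : ℝ} (h : ∀ v, w ⬝ᵥ v = 0 → v ⬝ᵥ A *ᵥ v ≤ ρ * (v ⬝ᵥ v)) :
    lambda2 A ≤ ρ := by
  obtain ⟨u, v, l, huu, hvv, huv, hu, hv, hl⟩ := exists_orthonormal_eigenvectors hA hι
  obtain ⟨p, q, hpq, horth⟩ : ∃ p q : ℝ, 0 < p ^ 2 + q ^ 2 ∧ p * (w ⬝ᵥ u) + q * (w ⬝ᵥ v) = 0 := by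
    by_cases h0 : w ⬝ᵥ u = 0
    · exact ⟨1, 0, by norm_num, by simp [h0]⟩
    · exact ⟨w ⬝ᵥ v, -(w ⬝ᵥ u), by rw [neg_sq]; positivity, by ring⟩
  have hrayleigh := h (p • u + q • v) (by
    rwa [dotProduct_add, dotProduct_smul, dotProduct_smul])
  simp only [Matrix.mulVec_add, Matrix.mulVec_smul, hu, hv, dotProduct_add, add_dotProduct,
    dotProduct_smul, smul_dotProduct, huu, hvv, huv, dotProduct_comm v u, smul_eq_mul]
    at hrayleigh
  have hq := mul_le_mul_of_nonneg_left hl (sq_nonneg q)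
  exact le_of_mul_le_mul_right (by linarith) hpq

theorem lambda2_mul_comm (A B : Matrix ι ι ℝ) : lambda2 (A * B) = lambda2 (B * A) := by
  rw [lambda2, lambda2, Matrix.charpoly_mul_comm]

end Lambda2

section Variance

variable {X Y : Type*} [Fintype X] [Fintype Y] {P : Matrix X Y ℝ} {μ : X → ℝ} {ρ : ℝ}

theorem fDiv_chiSq (ν μ : X → ℝ) : fDiv chiSq ν μ = ∑ x, (ν x - μ x) ^ 2 / μ x := by
  refine Finset.sum_congr rfl fun x _ => ?_
  by_cases hx : μ x = 0
  · simp [hx]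
  · rw [chiSq]
    field_simp

/-- Apply contraction to the perturbation `μ + c • (μ * h)`, with `c` so small that it is
nonnegative. -/
theorem Contracts.sum_sq_vecMul_div_le (hμ : μ ∈ stdSimplex ℝ X) (hc : Contracts chiSq ρ P μ)
    {h : X → ℝ} (hmean : ∑ x, μ x * h x = 0) :
    ∑ y, ((μ * h) ᵥ* P) y ^ 2 / (μ ᵥ* P) y ≤ ρ * ∑ x, μ x * h x ^ 2 := by
  set K := 1 + ∑ x, |h x|
  have hK : 0 < K := by positivity
  have htilt (x : X) : 0 ≤ 1 + K⁻¹ * h x := by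
    have hle : |h x| ≤ K := (Finset.single_le_sum (fun x _ => abs_nonneg (h x))
      (Finset.mem_univ x)).trans (by linarith)
    have : -1 ≤ h x / K := by
      rw [le_div_iff₀ hK]
      linarith [neg_abs_le (h x)]
    rw [inv_mul_eq_div]
    linarith
  set ν := μ + K⁻¹ • (μ * h)
  have hν : ν ∈ stdSimplex ℝ X := by
    refine ⟨fun x => ?_, ?_⟩
    · rw [show ν x = μ x * (1 + K⁻¹ * h x) by simp [ν]; ring]
      exact mul_nonneg (hμ.1 x) (htilt x)
    · simp [ν, Finset.sum_add_distrib, ← Finset.mul_sum, hmean, hμ.2]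
  have hcontr := hc ν hν fun x hx => by simp [ν, hx]
  have hsource : fDiv chiSq ν μ = K⁻¹ ^ 2 * ∑ x, μ x * h x ^ 2 := by
    rw [fDiv_chiSq, Finset.mul_sum]
    refine Finset.sum_congr rfl fun x _ => ?_
    by_cases hx : μ x = 0
    · simp [hx]
    · simp only [ν, Pi.add_apply, Pi.smul_apply, Pi.mul_apply, smul_eq_mul, add_sub_cancel_left]
      field_simp
  have htarget : fDiv chiSq (ν ᵥ* P) (μ ᵥ* P) =
      K⁻¹ ^ 2 * ∑ y, ((μ * h) ᵥ* P) y ^ 2 / (μ ᵥ* P) y := by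
    rw [fDiv_chiSq, Finset.mul_sum]
    simp only [ν, Matrix.add_vecMul, Matrix.smul_vecMul, Pi.add_apply, Pi.smul_apply,
      smul_eq_mul, add_sub_cancel_left, mul_pow, mul_div_assoc]
  rw [hsource, htarget, mul_left_comm] at hcontr
  exact le_of_mul_le_mul_left hcontr (by positivity)

/-- On mean-zero functions, `g ↦ P *ᵥ g` from `L²(μ ᵥ* P)` to `L²(μ)` is the adjoint of the action
of `P` on densities, so it has the same norm. -/
theorem Contracts.sum_mul_sq_mulVec_le (hP : ∀ x y, 0 ≤ P x y) (hμ : μ ∈ stdSimplex ℝ X)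
    (hρ : 0 ≤ ρ) (hc : Contracts chiSq ρ P μ) {g : Y → ℝ} (hmean : (μ ᵥ* P) ⬝ᵥ g = 0) :
    ∑ x, μ x * (P *ᵥ g) x ^ 2 ≤ ρ * ∑ y, (μ ᵥ* P) y * g y ^ 2 := by
  set h := P *ᵥ g
  have hmeanh : ∑ x, μ x * h x = 0 := (Matrix.dotProduct_mulVec μ P g).trans hmean
  have hμP (y : Y) : 0 ≤ (μ ᵥ* P) y := Finset.sum_nonneg fun x _ => mul_nonneg (hμ.1 x) (hP x y)
  set V := ∑ x, μ x * h x ^ 2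
  set G := ∑ y, (μ ᵥ* P) y * g y ^ 2
  have hV : 0 ≤ V := Finset.sum_nonneg fun x _ => mul_nonneg (hμ.1 x) (sq_nonneg _)
  have hG : 0 ≤ G := Finset.sum_nonneg fun y _ => mul_nonneg (hμP y) (sq_nonneg _)
  have hdual : V = ∑ y, ((μ * h) ᵥ* P) y * g y :=
    (Finset.sum_congr rfl fun x _ => by rw [Pi.mul_apply, sq, mul_assoc]).trans
      (Matrix.dotProduct_mulVec (μ * h) P g)
  have hcauchy : V ^ 2 ≤ (∑ y, ((μ * h) ᵥ* P) y ^ 2 / (μ ᵥ* P) y) * G := by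
    rw [hdual]
    refine Finset.sum_sq_le_sum_mul_sum_of_sq_le_mul _ (fun y _ => div_nonneg (sq_nonneg _) (hμP y))
      (fun y _ => mul_nonneg (hμP y) (sq_nonneg _)) fun y _ => ?_
    by_cases hy : (μ ᵥ* P) y = 0
    · simp [vecMul_mul_apply_eq_zero hP hμ.1 h hy]
    · exact le_of_eq (by field_simp)
  have hVV : V * V ≤ V * (ρ * G) := by
    have := mul_le_mul_of_nonneg_right (hc.sum_sq_vecMul_div_le hμ hmeanh) hG
    linarith
  rcases hV.eq_or_lt with h0 | hpos
  · exact h0 ▸ mul_nonneg hρ hG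
  · exact le_of_mul_le_mul_left hVV hpos

end Variance

section Spectral

variable {X Y : Type*} [Fintype X] [Fintype Y] {P : Matrix X Y ℝ} {μ : X → ℝ} {ρ : ℝ}

theorem Contracts.submatrix_support {f : ℝ → ℝ} (hc : Contracts f ρ P μ) :
    Contracts f ρ (P.submatrix id (Subtype.val : {y // (μ ᵥ* P) y ≠ 0} → Y)) μ := by
  intro ν hν hac
  refine le_of_eq_of_le ?_ (hc ν hν hac)
  exact (Finset.sum_subtype {y | (μ ᵥ* P) y ≠ 0} (by simp)
    fun y => (μ ᵥ* P) y * f ((ν ᵥ* P) y / (μ ᵥ* P) y)).symm.trans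
      (Finset.sum_filter_of_ne fun _ _ => left_ne_zero_of_mul)

/-- The matrix of `g ↦ P *ᵥ g`, from `L²(μ ᵥ* P)` to `L²(μ)`, in the orthonormal bases of
normalized indicators. -/
def normalizedKernel (P : Matrix X Y ℝ) (μ : X → ℝ) : Matrix X Y ℝ :=
  Matrix.of fun x y => √(μ x) * P x y * (√((μ ᵥ* P) y))⁻¹

theorem normalizedKernel_mulVec (P : Matrix X Y ℝ) (μ : X → ℝ) (v : Y → ℝ) (x : X) :
    (normalizedKernel P μ *ᵥ v) x = √(μ x) * (P *ᵥ fun y => v y / √((μ ᵥ* P) y)) x := by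
  simp only [Matrix.mulVec, dotProduct, Finset.mul_sum, normalizedKernel, Matrix.of_apply]
  exact Finset.sum_congr rfl fun y _ => by ring

variable [DecidableEq Y]

theorem lambda2_reversal_mul (hμ : ∀ x, 0 ≤ μ x) (hpos : ∀ y, 0 < (μ ᵥ* P) y) :
    lambda2 (reversal P μ * P) = lambda2 ((normalizedKernel P μ)ᵀ * normalizedKernel P μ) := by
  set s : Y → ℝ := fun y => √((μ ᵥ* P) y)
  have hs (y : Y) : s y ≠ 0 := (Real.sqrt_pos.2 (hpos y)).ne'
  have hconj : reversal P μ * P =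
      Matrix.diagonal s⁻¹ *
        ((normalizedKernel P μ)ᵀ * normalizedKernel P μ * Matrix.diagonal s) := by
    ext y y'
    rw [Matrix.diagonal_mul, Matrix.mul_diagonal, Matrix.mul_apply, Matrix.mul_apply,
      Finset.sum_mul, Finset.mul_sum]
    refine Finset.sum_congr rfl fun x _ => ?_
    calc μ x * P x y / (μ ᵥ* P) y * P x y'
        = √(μ x) ^ 2 * P x y / s y ^ 2 * P x y' := by
          rw [Real.sq_sqrt (hμ x), Real.sq_sqrt (hpos y).le]
      _ = (s y)⁻¹ * (√(μ x) * P x y * (s y)⁻¹ * (√(μ x) * P x y' * (s y')⁻¹) * s y') := by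
          field_simp [hs y, hs y']
  rw [hconj, lambda2_mul_comm, Matrix.mul_assoc, Matrix.diagonal_mul_diagonal]
  simp [hs]

theorem Contracts.lambda2_reversal_mul_le (hP : ∀ x y, 0 ≤ P x y) (hμ : μ ∈ stdSimplex ℝ X)
    (hpos : ∀ y, 0 < (μ ᵥ* P) y) (hY : 1 < Fintype.card Y) (hρ : 0 ≤ ρ)
    (hc : Contracts chiSq ρ P μ) : lambda2 (reversal P μ * P) ≤ ρ := by
  rw [lambda2_reversal_mul hμ.1 hpos]
  refine lambda2_le_of_forall_dotProduct_mulVec_le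
    (Matrix.isHermitian_conjTranspose_mul_self (normalizedKernel P μ)) hY
    (fun y => √((μ ᵥ* P) y)) fun v hv => ?_
  have hmean : ((μ ᵥ* P) ⬝ᵥ fun y => v y / √((μ ᵥ* P) y)) = 0 := by
    rw [← hv]
    refine Finset.sum_congr rfl fun y _ => ?_
    rw [mul_div_left_comm, Real.div_sqrt, mul_comm]
  calc v ⬝ᵥ ((normalizedKernel P μ)ᵀ * normalizedKernel P μ) *ᵥ v
      = ∑ x, μ x * (P *ᵥ fun y => v y / √((μ ᵥ* P) y)) x ^ 2 := by
        rw [← Matrix.mulVec_mulVec, Matrix.dotProduct_mulVec, Matrix.vecMul_transpose]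
        refine Finset.sum_congr rfl fun x _ => ?_
        rw [normalizedKernel_mulVec, ← sq, mul_pow, Real.sq_sqrt (hμ.1 x)]
    _ ≤ ρ * ∑ y, (μ ᵥ* P) y * (v y / √((μ ᵥ* P) y)) ^ 2 := hc.sum_mul_sq_mulVec_le hP hμ hρ hmean
    _ = ρ * (v ⬝ᵥ v) := by
        congr 1
        refine Finset.sum_congr rfl fun y _ => ?_
        rw [div_pow, Real.sq_sqrt (hpos y).le, mul_div_cancel₀ _ (hpos y).ne', sq]

end Spectral

section UpDownWalk

variable {α : Type*} [Fintype α] [DecidableEq α] {k l : ℕ} {m : Slice α k → ℝ} {ρ : ℝ}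

theorem le_card_support_marginal_one (hm : m ∈ stdSimplex ℝ (Slice α k)) :
    k ≤ Fintype.card {B : Slice α 1 // marginal 1 m B ≠ 0} := by
  obtain ⟨A, -, hA⟩ : ∃ A ∈ Finset.univ, m A ≠ 0 :=
    Finset.exists_ne_zero_of_sum_ne_zero (hm.2 ▸ one_ne_zero)
  have hpos (a : A.1) : marginal 1 m ⟨{a.1}, Finset.card_singleton _⟩ ≠ 0 := by
    have hdown : down α k 1 A ⟨{a.1}, Finset.card_singleton _⟩ ≠ 0 := by
      have hk : k ≠ 0 := A.2 ▸ Finset.card_ne_zero_of_mem a.2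
      simp [down, hk]
    refine (Finset.sum_pos' (fun A _ => mul_nonneg (hm.1 A) (down_nonneg A _))
      ⟨A, Finset.mem_univ A, ?_⟩).ne'
    exact (mul_nonneg (hm.1 A) (down_nonneg A _)).lt_of_ne (mul_ne_zero hA hdown).symm
  have hcard := Fintype.card_le_of_injective
    (fun a : A.1 => (⟨⟨{a.1}, Finset.card_singleton _⟩, hpos a⟩ :
      {B : Slice α 1 // marginal 1 m B ≠ 0}))
    fun a b hab => Subtype.ext (Finset.singleton_injective (congrArg (fun B => B.1.1) hab))
  rwa [Fintype.card_coe, A.2] at hcard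

theorem Contracts.lambda2_upDownWalk_le (hl : l ≤ k) (hm : m ∈ stdSimplex ℝ (Slice α k))
    (hcard : 1 < Fintype.card {B : Slice α l // marginal l m B ≠ 0}) (hρ : 0 ≤ ρ)
    (hc : Contracts chiSq ρ (down α k l) m) : lambda2 (upDownWalk l m) ≤ ρ := by
  rw [upDownWalk, up_eq_reversal_down hl]
  exact hc.submatrix_support.lambda2_reversal_mul_le (fun A B => down_nonneg A B.1) hm
    (fun B => ((marginal_mem_stdSimplex hl hm).1 B.1).lt_of_ne B.2.symm) hcard hρ

end UpDownWalk

end DownUp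

end

theorem mainTheorem5_general {n : ℕ} (hn : 2 ≤ n) {S : Fin n → Type*}
    [∀ i, Fintype (S i)] [∀ i, DecidableEq (S i)]
    (μ : (∀ i, S i) → ℝ) (hμ : μ ∈ stdSimplex ℝ (∀ i, S i)) (C : ℝ) (hC : 0 < C) :
    (DownUp.Contracts DownUp.chiSq (1 - 1 / (C * n)) (DownUp.down (Σ i, S i) n (n - 1))
        (DownUp.hom μ) →
      DownUp.Contracts DownUp.chiSq (1 - 1 / (2 * max C 1)) (DownUp.down (Σ i, S i) 2 1)
        (DownUp.marginal 2 (DownUp.hom μ)) ∧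
      DownUp.lambda2 (DownUp.upDownWalk 1 (DownUp.marginal 2 (DownUp.hom μ)))
        ≤ 1 - 1 / (2 * max C 1)) ∧
    (DownUp.Contracts DownUp.kl (1 - 1 / (C * n)) (DownUp.down (Σ i, S i) n (n - 1))
        (DownUp.hom μ) →
      DownUp.Contracts DownUp.kl (1 - 1 / (2 * max C 1)) (DownUp.down (Σ i, S i) 2 1)
        (DownUp.marginal 2 (DownUp.hom μ))) := by
  refine ⟨fun h => ?_, .marginal_two DownUp.isEntropyGenerator_kl hn hμ hC⟩
  have hpair := h.marginal_two DownUp.isEntropyGenerator_chiSq hn hμ hC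
  have hmem := DownUp.marginal_mem_stdSimplex hn (DownUp.hom_mem_stdSimplex hμ)
  have hrate : 1 / (2 * max C 1) ≤ 1 :=
    div_le_one_of_le₀ (by linarith [le_max_right C 1]) (by positivity)
  exact ⟨hpair, hpair.lambda2_upDownWalk_le one_le_two hmem
    (DownUp.le_card_support_marginal_one hmem) (sub_nonneg.2 hrate)⟩

theorem mainTheorem5 {n : ℕ} (hn : 2 ≤ n) {S : Fin n → Type*}
    [∀ i, Fintype (S i)] [∀ i, DecidableEq (S i)]
    (μ : (∀ i, S i) → ℝ) (hμ : μ ∈ stdSimplex ℝ (∀ i, S i)) (C : ℝ) (hC : 0 < C) :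
    (DownUp.Contracts DownUp.chiSq (1 - 1 / (C * n)) (DownUp.down (Σ i, S i) n (n - 1))
        (DownUp.hom μ) →
      DownUp.Contracts DownUp.chiSq (1 - 1 / (2 * (C + 1))) (DownUp.down (Σ i, S i) 2 1)
        (DownUp.marginal 2 (DownUp.hom μ)) ∧
      DownUp.lambda2 (DownUp.upDownWalk 1 (DownUp.marginal 2 (DownUp.hom μ)))
        ≤ 1 - 1 / (2 * (C + 1))) ∧
    (DownUp.Contracts DownUp.kl (1 - 1 / (C * n)) (DownUp.down (Σ i, S i) n (n - 1))
        (DownUp.hom μ) →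
      DownUp.Contracts DownUp.kl (1 - 1 / (2 * (C + 1))) (DownUp.down (Σ i, S i) 2 1)
        (DownUp.marginal 2 (DownUp.hom μ))) := by
  obtain ⟨hchiSq, hkl⟩ := mainTheorem5_general hn μ hμ C hC
  have hmem := DownUp.marginal_mem_stdSimplex hn (DownUp.hom_mem_stdSimplex hμ)
  have hrate : 1 - 1 / (2 * max C 1) ≤ 1 - 1 / (2 * (C + 1)) := by
    gcongr
    exact max_le (by linarith) (by linarith)
  have hchiSq' := DownUp.isEntropyGenerator_chiSq
  have hkl' := DownUp.isEntropyGenerator_kl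
  exact ⟨fun h => (hchiSq h).imp (.mono hchiSq'.convexOn hchiSq'.map_one hmem · hrate)
    (le_trans · hrate), fun h => (hkl h).mono hkl'.convexOn hkl'.map_one hmem hrate⟩
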